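/- Let $R$ be a commutative ring, $H$ a Hopf $R$-algebra, and write $H^*=\mathrm{Hom}_R(H,R)$, with convolution product $(f\star g)(h)=\sum f(h_1)g(h_2)$ and right regular action $(fh)(k)=f(hk)$. Assume that $H$ is locally projective as an $R$-module, i.e. for every $R$-module $M$ the map $M\otimes_R H\to \mathrm{Hom}_R(H^*,M)$, $m\otimes h\mapsto[g\mapsto g(h)m]$, is injective, and that $H$ has a twisted antipode $\overline S$, i.e. an $R$-linear map with $\sum\overline S(h_2)h_1=\varepsilon(h)1=\sum h_2\overline S(h_1)$ for all $h\in H$. Let $A$ be an $R$-algebra with a weak left $H$-action, i.e. an $R$-linear map $H\otimes_R A\to A$, $h\otimes a\mapsto ha$, with $h(ab)=\sum(h_1a)(h_2b)$, $h1_A=\varepsilon(h)1_A$ and $1_Ha=a$. Let $\sigma:H\otimes_RH\to A$ be an $R$-linear map that is invertible, with inverse $\sigma^{-1}$, in the convolution algebra $\mathrm{Hom}_R(H\otimes_RH,A)$, and such that $A\#_\sigma H:=A\otimes_RH$ with multiplication $$(a\#h)(b\#k)=\sum a(h_1b)\,\sigma(h_2\otimes k_1)\#h_3k_2$$ is associative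 with unity $1_A\#1_H$ (a right $H$-crossed product). It carries the right $H$-coaction $\mathrm{id}_A\otimes\Delta_H$. Let $U\subseteq H^*$ be a right $H$-module subalgebra, i.e. an $R$-submodule closed under $\star$ and under the right regular $H$-action (it need not contain $\varepsilon$). For an $R$-algebra $B$ with a right $H$-coaction $b\mapsto\sum b_{<0>}\otimes b_{<1>}$, let $B\#U:=B\otimes_RU$ with multiplication $(b\#f)(c\#g)=\sum bc_{<0>}\#(fc_{<1>})\star g$; this is used for $B=A\#_\sigma H$ and for $B=H$ (with coaction $\Delta_H$). Let $H^*$ act on itself from the right by $(f\leftharpoonup g)(h)=\sum g(h_3\overline S(h_1))f(h_2)$, and let $H^\upsilon\subseteq H^*$ be the rational submodule: the set of $f\in H^*$ for which there is $\upsilon(f)=\sum f_{<-1>}\otimes f_{<0>}\in H\otimes_RH^*$ (then unique) such that $f\leftharpoonup g=\sum g(f_{<-1>})f_{<0>}$ for all $g\in H^*$. Let $V:=\upsilon^{-1}(H\otimes_RU)$ be the set of $f\in H^\upsilon$ such that $\upsilon(f)$ lies in the image of $H\otimes_RU$ in $H\otimes_R H^*$, and let $J:A\otimes_RV\to\mathrm{Hom}_R(H,A)$,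 $a\otimes f\mapsto[k\mapsto f(k)a]$. Define $\varphi,\psi:H\otimes_RA\to\mathrm{Hom}_R(H,A)$ by $$\varphi(h\otimes a)(k)=\sum[\overline S(k_2)a]\,\sigma(\overline S(k_1)\otimes h),$$ $$\psi(h\otimes a)(k)=\sum\sigma^{-1}(k_3\otimes\overline S(k_2))\,[k_4a]\,\sigma(k_5\otimes\overline S(k_1)h),$$ and assume that $\varphi(H\otimes_RA)\subseteq J(A\otimes_RV)$ and $\psi(H\otimes_RA)\subseteq J(A\otimes_RV)$. Let $\alpha:(A\otimes_RH)\otimes_RU\to\mathrm{Hom}_R(H,A\otimes_RH)$, $x\otimes f\mapsto[k\mapsto f(k)x]$. (1) If $\alpha$ is injective, then there is an isomorphism of $R$-algebras (an $R$-linear multiplicative bijection, sending unity to unity if $\varepsilon\in U$) $$(A\#_\sigma H)\#U\;\cong\;A\otimes_R(H\#U).$$ (2) If $R$ is Noetherian and $U\subseteq R^H$ (the module of all functions $H\to R$) is $A$-pure, i.e. $U\otimes_RA\to R^H\otimes_RA$ is injective, then $\alpha$ is injective, so the isomorphism in (1) exists. -/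

import Mathlib

open TensorProduct

universe u v w

noncomputable section

namespace HopfDuality

open Coalgebra WithConv

/-! ### Pairings and local projectivity -/

section Pairings

variable {R : Type u} [CommRing R]

/-- For a pairing `β : V → W^*` and an `R`-module `M`, the canonical map
`M ⊗ W → Hom(V, M)`, `m ⊗ w ↦ [v ↦ ⟨v, w⟩ m]`. -/
def alphaMap {V W : Type*} [AddCommMonoid V] [Module R V] [AddCommMonoid W] [Module R W]
    (β : V →ₗ[R] W →ₗ[R] R) (M : Type*) [AddCommMonoid M] [Module R M] :
    M ⊗[R] W →ₗ[R] V →ₗ[R] M :=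
  TensorProduct.lift (LinearMap.mk₂ R (fun m x => (β.flip x).smulRight m)
    (fun m m' x => by ext y; simp)
    (fun c m x => by ext y; exact smul_comm _ _ _)
    (fun m x x' => by ext y; simp [add_smul])
    (fun c m x => by ext y; simp [mul_smul]))

@[simp]
theorem alphaMap_tmul {V W : Type*} [AddCommMonoid V] [Module R V] [AddCommMonoid W] [Module R W]
    (β : V →ₗ[R] W →ₗ[R] R) (M : Type*) [AddCommMonoid M] [Module R M] (m : M) (x : W) (y : V) :
    alphaMap β M (m ⊗ₜ[R] x) y = β y x • m := by
  simp [alphaMap]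

/-- The pairing `(H, U)` given by evaluation, for a submodule `U` of `H^*`. -/
def evalPairing {H : Type*} [AddCommGroup H] [Module R H] (U : Submodule R (Module.Dual R H)) :
    H →ₗ[R] U →ₗ[R] R :=
  U.subtype.flip

/-- `W` is locally projective: the pairing `(W^*, W)` satisfies the `α`-condition, i.e.
`M ⊗ W → Hom(W^*, M)` is injective for every `R`-module `M`. (Modules in the universe of `R`
suffice, see `IsLocallyProjective.alphaMap_injective`.) -/
def IsLocallyProjective (R : Type u) [CommRing R] (W : Type v) [AddCommGroup W] [Module R W] :
    Prop :=
  ∀ (M : Type u) [AddCommGroup M] [Module R M],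
    Function.Injective
      (alphaMap (LinearMap.id : Module.Dual R W →ₗ[R] (W →ₗ[R] R)) M)

theorem IsLocallyProjective.alphaMap_injective {W : Type v} [AddCommGroup W] [Module R W]
    (hW : IsLocallyProjective R W) (M : Type*) [AddCommGroup M] [Module R M] :
    Function.Injective
      (alphaMap (LinearMap.id : Module.Dual R W →ₗ[R] (W →ₗ[R] R)) M) := by
  rw [injective_iff_map_eq_zero]
  intro t ht
  obtain ⟨n, m, x, rfl⟩ : ∃ (n : ℕ) (m : Fin n → M) (x : Fin n → W),
      t = ∑ i, m i ⊗ₜ[R] x i := by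
    obtain ⟨s, rfl⟩ := TensorProduct.exists_finset t
    refine ⟨s.card, fun i => (s.equivFin.symm i).1.1, fun i => (s.equivFin.symm i).1.2, ?_⟩
    rw [← Finset.sum_coe_sort s (fun i => i.1 ⊗ₜ[R] i.2)]
    exact (Equiv.sum_comp s.equivFin.symm (fun i => (i : M × W).1 ⊗ₜ[R] (i : M × W).2)).symm
  have hf : ∀ f : Module.Dual R W, ∑ i, f (x i) • m i = 0 := fun f => by
    simpa [LinearMap.sum_apply] using LinearMap.congr_fun ht f
  let K : Submodule R (Fin n → R) :=
    LinearMap.range (LinearMap.pi (fun i => Module.Dual.eval R W (x i)))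
  let p : ((Fin n → R) ⧸ K) →ₗ[R] M := K.liftQ (Fintype.linearCombination R m) (by
    rintro _ ⟨f, rfl⟩
    simpa [Fintype.linearCombination_apply] using hf f)
  have h0 : (∑ i, K.mkQ (Pi.single i 1) ⊗ₜ[R] x i) = 0 := by
    apply hW ((Fin n → R) ⧸ K)
    ext f
    simp only [map_sum, LinearMap.sum_apply, alphaMap_tmul, LinearMap.id_apply, map_zero,
      LinearMap.zero_apply]
    simp only [← map_smul, ← map_sum]
    rw [Submodule.mkQ_apply, Submodule.Quotient.mk_eq_zero]
    refine ⟨f, ?_⟩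
    ext j
    simp [Finset.sum_apply, Pi.single_apply]
  have h1 := congrArg (LinearMap.rTensor W p) h0
  simpa [p, Fintype.linearCombination_apply_single] using h1

end Pairings

/-! ### The dual of a bialgebra, right module subalgebras -/

section DualAlgebra

variable (R : Type u) [CommRing R] (H : Type v) [Ring H] [Bialgebra R H]

/-- The convolution product `(f ⋆ g)(h) = ∑ f(h₁) g(h₂)` on `H^*`, as a bilinear map. -/
def dualConv : Module.Dual R H →ₗ[R] Module.Dual R H →ₗ[R] Module.Dual R H :=
  TensorProduct.curry ((comul (R := R) (A := H)).dualMap ∘ₗ TensorProduct.dualDistrib R H H)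

/-- The right regular action `(f h)(k) = f(h k)` of `H` on `H^*`. -/
def rightRegular : Module.Dual R H →ₗ[R] H →ₗ[R] Module.Dual R H :=
  LinearMap.mk₂ R (fun f h => f ∘ₗ LinearMap.mulLeft R h)
    (fun f f' h => by ext k; simp)
    (fun c f h => by ext k; simp)
    (fun f h h' => by ext k; simp [add_mul])
    (fun c f h => by ext k; simp)

/-- A right `H`-module subalgebra `U` of `H^*`: a submodule closed under convolution and under the
right regular `H`-action. It need not contain the unit `ε` of `H^*`. -/
structure RightModuleSubalgebra extends Submodule R (Module.Dual R H) where
  conv_mem : ∀ f ∈ carrier, ∀ g ∈ carrier, dualConv R H f g ∈ carrier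
  act_mem : ∀ f ∈ carrier, ∀ h : H, rightRegular R H f h ∈ carrier

variable {R H}

/-- Convolution on `U`. -/
def RightModuleSubalgebra.conv (U : RightModuleSubalgebra R H) :
    U.toSubmodule →ₗ[R] U.toSubmodule →ₗ[R] U.toSubmodule :=
  LinearMap.mk₂ R (fun f g => ⟨dualConv R H f g, U.conv_mem f f.2 g g.2⟩)
    (fun _ _ _ => Subtype.ext (by simp))
    (fun _ _ _ => Subtype.ext (by simp))
    (fun _ _ _ => Subtype.ext (by simp))
    (fun _ _ _ => Subtype.ext (by simp))

/-- The right regular action on `U`. -/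
def RightModuleSubalgebra.act (U : RightModuleSubalgebra R H) :
    U.toSubmodule →ₗ[R] H →ₗ[R] U.toSubmodule :=
  LinearMap.mk₂ R (fun f h => ⟨rightRegular R H f h, U.act_mem f f.2 h⟩)
    (fun _ _ _ => Subtype.ext (by simp))
    (fun _ _ _ => Subtype.ext (by simp))
    (fun _ _ _ => Subtype.ext (by simp))
    (fun _ _ _ => Subtype.ext (by simp))

end DualAlgebra

/-! ### Right smash products `B # U` -/

section Smash

variable {R : Type u} [CommRing R] {H : Type v} [Ring H] [Bialgebra R H]
  {B : Type*} [NonUnitalNonAssocRing B] [Module R B] [SMulCommClass R B B] [IsScalarTower R B B]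

/-- The smash product `B # U = B ⊗ U` for an `R`-algebra `B` with a right coaction
`ρ : B → B ⊗ H`. -/
def SmashProduct (_ρ : B →ₗ[R] B ⊗[R] H) (U : RightModuleSubalgebra R H) : Type _ :=
  B ⊗[R] U.toSubmodule

namespace SmashProduct

variable (ρ : B →ₗ[R] B ⊗[R] H) (U : RightModuleSubalgebra R H)

instance : AddCommGroup (SmashProduct ρ U) :=
  inferInstanceAs (AddCommGroup (B ⊗[R] U.toSubmodule))

instance : Module R (SmashProduct ρ U) :=
  inferInstanceAs (Module R (B ⊗[R] U.toSubmodule))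

/-- The element `b # f`. -/
def mk (b : B) (f : U.toSubmodule) : SmashProduct ρ U := b ⊗ₜ[R] f

/-- `f ⊗ (h ⊗ g) ↦ (f h) ⋆ g`. -/
def actConv : U.toSubmodule ⊗[R] (H ⊗[R] U.toSubmodule) →ₗ[R] U.toSubmodule :=
  TensorProduct.lift U.conv
    ∘ₗ LinearMap.rTensor U.toSubmodule (TensorProduct.lift U.act)
    ∘ₗ (TensorProduct.assoc R U.toSubmodule H U.toSubmodule).symm.toLinearMap

/-- The multiplication `(b # f)(c # g) = ∑ b c₀ # (f c₁) ⋆ g`, where `ρ c = ∑ c₀ ⊗ c₁`. -/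
def mul : (B ⊗[R] U.toSubmodule) ⊗[R] (B ⊗[R] U.toSubmodule) →ₗ[R] B ⊗[R] U.toSubmodule :=
  TensorProduct.map (LinearMap.mul' R B) (actConv U)
    ∘ₗ (TensorProduct.tensorTensorTensorComm R B U.toSubmodule B (H ⊗[R] U.toSubmodule)).toLinearMap
    ∘ₗ LinearMap.lTensor (B ⊗[R] U.toSubmodule)
        ((TensorProduct.assoc R B H U.toSubmodule).toLinearMap
          ∘ₗ LinearMap.rTensor U.toSubmodule ρ)

instance : NonUnitalNonAssocRing (SmashProduct ρ U) where
  __ := (inferInstance : AddCommGroup (SmashProduct ρ U))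
  mul x y := mul ρ U (TensorProduct.tmul R x y)
  left_distrib x y z := by
    change mul ρ U (TensorProduct.tmul R x (y + z)) = mul ρ U _ + mul ρ U _
    rw [← map_add]; exact congrArg _ (TensorProduct.tmul_add _ _ _)
  right_distrib x y z := by
    change mul ρ U (TensorProduct.tmul R (x + y) z) = mul ρ U _ + mul ρ U _
    rw [← map_add]; exact congrArg _ (TensorProduct.add_tmul _ _ _)
  zero_mul x := (congrArg _ (TensorProduct.zero_tmul _ _)).trans (map_zero (mul ρ U))
  mul_zero x := (congrArg _ (TensorProduct.tmul_zero _ _)).trans (map_zero (mul ρ U))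

theorem mul_def (x y : SmashProduct ρ U) : x * y = mul ρ U (TensorProduct.tmul R x y) := rfl

instance : IsScalarTower R (SmashProduct ρ U) (SmashProduct ρ U) where
  smul_assoc c x y := LinearMap.map_smul₂ (TensorProduct.curry (mul ρ U)) c x y

instance : SMulCommClass R (SmashProduct ρ U) (SmashProduct ρ U) where
  smul_comm c x y := ((TensorProduct.curry (mul ρ U) x).map_smul c y).symm

end SmashProduct

end Smash

/-! ### Crossed products `A #_σ H` -/

section Crossed

variable {R : Type u} [CommRing R] {H : Type v} [Ring H] [Bialgebra R H]
  {A : Type w} [Ring A] [Algebra R A]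

/-- A weak left `H`-action `h a = act h a` on `A`: the map `a ↦ [h ↦ h a]` from `A` to the
convolution algebra `Hom(H, A)` is an algebra morphism, and `1 a = a`. -/
structure IsWeakAction (act : H →ₗ[R] A →ₗ[R] A) : Prop where
  map_mul : ∀ a b : A, toConv (act.flip (a * b)) = toConv (act.flip a) * toConv (act.flip b)
  map_one : toConv (act.flip 1) = 1
  one_act : ∀ a : A, act 1 a = a

/-- The module `A ⊗ H` underlying `A #_σ H`. -/
def CrossedProduct (_act : H →ₗ[R] A →ₗ[R] A) (_σ : H ⊗[R] H →ₗ[R] A) : Type _ := A ⊗[R] H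

namespace CrossedProduct

variable (act : H →ₗ[R] A →ₗ[R] A) (σ : H ⊗[R] H →ₗ[R] A)

instance : AddCommGroup (CrossedProduct act σ) := inferInstanceAs (AddCommGroup (A ⊗[R] H))

instance : Module R (CrossedProduct act σ) := inferInstanceAs (Module R (A ⊗[R] H))

/-- The element `a # h`. -/
def mk (a : A) (h : H) : CrossedProduct act σ := a ⊗ₜ[R] h

variable (R H A) in
/-- `a ⊗ (b ⊗ h) ↦ a b ⊗ h`. -/
def leftMul : A ⊗[R] (A ⊗[R] H) →ₗ[R] A ⊗[R] H :=
  LinearMap.rTensor H (LinearMap.mul' R A) ∘ₗ (TensorProduct.assoc R A A H).symm.toLinearMap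

/-- `h ⊗ k ↦ ∑ σ(h₁ ⊗ k₁) ⊗ h₂ k₂`. -/
def cocycleMul : H ⊗[R] H →ₗ[R] A ⊗[R] H :=
  TensorProduct.map σ (LinearMap.mul' R H)
    ∘ₗ (TensorProduct.tensorTensorTensorComm R H H H H).toLinearMap
    ∘ₗ TensorProduct.map comul comul

/-- `h ⊗ (b ⊗ k) ↦ ∑ (h₁ b) σ(h₂ ⊗ k₁) ⊗ h₃ k₂`. -/
def twistMul : H ⊗[R] (A ⊗[R] H) →ₗ[R] A ⊗[R] H :=
  leftMul R H A
    ∘ₗ TensorProduct.map (TensorProduct.lift act) (cocycleMul σ)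
    ∘ₗ (TensorProduct.tensorTensorTensorComm R H H A H).toLinearMap
    ∘ₗ LinearMap.rTensor (A ⊗[R] H) comul

/-- The multiplication `(a # h)(b # k) = ∑ a (h₁ b) σ(h₂ ⊗ k₁) # h₃ k₂`. -/
def mul : (A ⊗[R] H) ⊗[R] (A ⊗[R] H) →ₗ[R] A ⊗[R] H :=
  leftMul R H A
    ∘ₗ LinearMap.lTensor A (twistMul act σ)
    ∘ₗ (TensorProduct.assoc R A H (A ⊗[R] H)).toLinearMap

instance : NonUnitalNonAssocRing (CrossedProduct act σ) where
  __ := (inferInstance : AddCommGroup (CrossedProduct act σ))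
  mul x y := mul act σ (TensorProduct.tmul R x y)
  left_distrib x y z := by
    change mul act σ (TensorProduct.tmul R x (y + z)) = mul act σ _ + mul act σ _
    rw [← map_add]; exact congrArg _ (TensorProduct.tmul_add _ _ _)
  right_distrib x y z := by
    change mul act σ (TensorProduct.tmul R (x + y) z) = mul act σ _ + mul act σ _
    rw [← map_add]; exact congrArg _ (TensorProduct.add_tmul _ _ _)
  zero_mul x := (congrArg _ (TensorProduct.zero_tmul _ _)).trans (map_zero (mul act σ))
  mul_zero x := (congrArg _ (TensorProduct.tmul_zero _ _)).trans (map_zero (mul act σ))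

theorem mul_def (x y : CrossedProduct act σ) :
    x * y = mul act σ (TensorProduct.tmul R x y) := rfl

instance : IsScalarTower R (CrossedProduct act σ) (CrossedProduct act σ) where
  smul_assoc c x y := LinearMap.map_smul₂ (TensorProduct.curry (mul act σ)) c x y

instance : SMulCommClass R (CrossedProduct act σ) (CrossedProduct act σ) where
  smul_comm c x y := ((TensorProduct.curry (mul act σ) x).map_smul c y).symm

/-- The right `H`-coaction `id ⊗ Δ` on `A #_σ H`. -/
def coaction : CrossedProduct act σ →ₗ[R] CrossedProduct act σ ⊗[R] H :=
  (TensorProduct.assoc R A H H).symm.toLinearMap ∘ₗ LinearMap.lTensor A comul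

end CrossedProduct

/-- `A #_σ H` is a right `H`-crossed product: `act` is a weak action and the multiplication of
`A #_σ H` is associative with unity `1 # 1`. -/
structure IsCrossedProduct (act : H →ₗ[R] A →ₗ[R] A) (σ : H ⊗[R] H →ₗ[R] A) : Prop where
  isWeakAction : IsWeakAction act
  mul_assoc : ∀ x y z : CrossedProduct act σ, x * y * z = x * (y * z)
  one_mul : ∀ x : CrossedProduct act σ, CrossedProduct.mk act σ 1 1 * x = x
  mul_one : ∀ x : CrossedProduct act σ, x * CrossedProduct.mk act σ 1 1 = x

/-- `σ'` is the inverse of `σ` in the convolution algebra `Hom(H ⊗ H, A)`. -/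
structure IsConvInverse (σ σ' : H ⊗[R] H →ₗ[R] A) : Prop where
  mul_inv : toConv σ * toConv σ' = 1
  inv_mul : toConv σ' * toConv σ = 1

end Crossed

/-! ### Twisted antipodes, the submodule `H^υ`, and the maps `φ`, `ψ` -/

section Twisted

variable {R : Type u} [CommRing R] {H : Type v} [Ring H] [Bialgebra R H]
  {A : Type w} [Ring A] [Algebra R A]

/-- `T` is a twisted antipode of `H`, i.e. an antipode of `H^op`:
`∑ T(h₂) h₁ = ε(h) 1 = ∑ h₂ T(h₁)`. -/
structure IsTwistedAntipode (T : H →ₗ[R] H) : Prop where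
  mul_left : LinearMap.mul' R H ∘ₗ LinearMap.rTensor H T
    ∘ₗ (TensorProduct.comm R H H).toLinearMap ∘ₗ comul = Algebra.linearMap R H ∘ₗ counit
  mul_right : LinearMap.mul' R H ∘ₗ LinearMap.lTensor H T
    ∘ₗ (TensorProduct.comm R H H).toLinearMap ∘ₗ comul = Algebra.linearMap R H ∘ₗ counit

variable (T : H →ₗ[R] H)

/-- `h ↦ ∑ h₃ T(h₁) ⊗ h₂`. -/
def twistedCoadjoint : H →ₗ[R] H ⊗[R] H :=
  (TensorProduct.comm R H H).toLinearMap
    ∘ₗ LinearMap.lTensor H (LinearMap.mul' R H ∘ₗ LinearMap.lTensor H T)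
    ∘ₗ (TensorProduct.assoc R H H H).toLinearMap
    ∘ₗ (TensorProduct.comm R H (H ⊗[R] H)).toLinearMap
    ∘ₗ LinearMap.lTensor H comul ∘ₗ comul

/-- The right `H^*`-action `(f ↼ g)(h) = ∑ g(h₃ T(h₁)) f(h₂)` on `H^*`, as the map
`f ↦ [g ↦ f ↼ g]`. -/
def twistedAction : Module.Dual R H →ₗ[R] Module.Dual R H →ₗ[R] Module.Dual R H :=
  (TensorProduct.curry
    ((twistedCoadjoint T).dualMap ∘ₗ TensorProduct.dualDistrib R H H)).flip

/-- The canonical map `H^* ⊗ H → Hom(H^*, H^*)`, `f ⊗ h ↦ [g ↦ g(h) f]`. -/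
def ratMap (R : Type u) [CommRing R] (H : Type v) [Ring H] [Bialgebra R H] :
    Module.Dual R H ⊗[R] H →ₗ[R] Module.Dual R H →ₗ[R] Module.Dual R H :=
  alphaMap (LinearMap.id : Module.Dual R H →ₗ[R] (H →ₗ[R] R)) (Module.Dual R H)

/-- `H^υ`, the rational submodule of `H^*` under the action `twistedAction`: those `f` for which
there is `∑ f₋₁ ⊗ f₀ ∈ H ⊗ H^*` with `f ↼ g = ∑ g(f₋₁) f₀` for all `g ∈ H^*`. -/
def upsilonSubmodule : Submodule R (Module.Dual R H) :=
  (LinearMap.range (ratMap R H)).comap (twistedAction T)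

/-- The coaction `υ : H^υ → H ⊗ H^*`, `f ↦ ∑ f₋₁ ⊗ f₀`, determined by
`f ↼ g = ∑ g(f₋₁) f₀` for all `g ∈ H^*`. -/
def upsilon (hH : IsLocallyProjective R H) :
    upsilonSubmodule T →ₗ[R] H ⊗[R] Module.Dual R H :=
  (TensorProduct.comm R (Module.Dual R H) H).toLinearMap
    ∘ₗ (LinearEquiv.ofInjective (ratMap R H)
        (hH.alphaMap_injective (Module.Dual R H))).symm.toLinearMap
    ∘ₗ (twistedAction T).restrict (fun _ hf => hf)

/-- The defining property of `υ`. -/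
theorem ratMap_upsilon (hH : IsLocallyProjective R H) (f : upsilonSubmodule T) :
    ratMap R H ((TensorProduct.comm R H _) (upsilon T hH f)) = twistedAction T f := by
  have := congrArg Subtype.val (LinearEquiv.apply_symm_apply
    (LinearEquiv.ofInjective (ratMap R H) (hH.alphaMap_injective (Module.Dual R H)))
    ((twistedAction T).restrict (p := upsilonSubmodule T) (fun _ hf => hf) f))
  simp only [upsilon, LinearMap.comp_apply, LinearEquiv.coe_coe]
  rw [← TensorProduct.comm_symm, LinearEquiv.symm_apply_apply]
  exact this

/-- `υ⁻¹(H ⊗ U)`, as a submodule of `H^*`. -/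
def upsilonPreimage (hH : IsLocallyProjective R H) (U : Submodule R (Module.Dual R H)) :
    Submodule R (Module.Dual R H) :=
  ((LinearMap.range (LinearMap.lTensor H U.subtype)).comap (upsilon T hH)).map
    (upsilonSubmodule T).subtype

/-- `φ : H ⊗ A → Hom(H, A)`, `φ(h ⊗ a)(k) = ∑ [T(k₂) a] σ(T(k₁) ⊗ h)`. -/
def phi (act : H →ₗ[R] A →ₗ[R] A) (σ : H ⊗[R] H →ₗ[R] A) : H ⊗[R] A →ₗ[R] H →ₗ[R] A :=
  TensorProduct.lift (LinearMap.mk₂ R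
    (fun h a => LinearMap.mul' R A
      ∘ₗ TensorProduct.map (act.flip a ∘ₗ T) (σ ∘ₗ (TensorProduct.mk R H H).flip h ∘ₗ T)
      ∘ₗ (TensorProduct.comm R H H).toLinearMap ∘ₗ comul)
    (fun h h' a => by
      simp only [map_add, LinearMap.add_comp, LinearMap.comp_add, TensorProduct.map_add_right])
    (fun c h a => by
      simp only [map_smul, LinearMap.smul_comp, LinearMap.comp_smul, TensorProduct.map_smul_right])
    (fun h a a' => by
      simp only [map_add, LinearMap.add_comp, LinearMap.comp_add, TensorProduct.map_add_left])
    (fun c h a => by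
      simp only [map_smul, LinearMap.smul_comp, LinearMap.comp_smul, TensorProduct.map_smul_left]))

/-- `a ↦ [k ↦ ∑ σ'(k₂ ⊗ T(k₁)) (k₃ a)]`. -/
def psiLeft (act : H →ₗ[R] A →ₗ[R] A) (σ' : H ⊗[R] H →ₗ[R] A) : A →ₗ[R] H →ₗ[R] A where
  toFun a := LinearMap.mul' R A
    ∘ₗ TensorProduct.map
        (σ' ∘ₗ LinearMap.lTensor H T ∘ₗ (TensorProduct.comm R H H).toLinearMap ∘ₗ comul)
        (act.flip a)
    ∘ₗ comul
  map_add' a a' := by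
    simp only [map_add, LinearMap.add_comp, LinearMap.comp_add, TensorProduct.map_add_right]
  map_smul' c a := by
    simp only [map_smul, LinearMap.smul_comp, LinearMap.comp_smul, TensorProduct.map_smul_right,
      RingHom.id_apply]

/-- `ψ : H ⊗ A → Hom(H, A)`,
`ψ(h ⊗ a)(k) = ∑ σ'(k₃ ⊗ T(k₂)) [k₄ a] σ(k₅ ⊗ T(k₁) h)`, where `σ'` is the inverse of `σ`. -/
def psi (act : H →ₗ[R] A →ₗ[R] A) (σ σ' : H ⊗[R] H →ₗ[R] A) : H ⊗[R] A →ₗ[R] H →ₗ[R] A :=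
  TensorProduct.lift (LinearMap.mk₂ R
    (fun h a => LinearMap.mul' R A
      ∘ₗ TensorProduct.map (psiLeft T act σ' a)
          (σ ∘ₗ LinearMap.lTensor H ((LinearMap.mul R H).flip h ∘ₗ T))
      ∘ₗ (TensorProduct.assoc R H H H).toLinearMap
      ∘ₗ (TensorProduct.comm R H (H ⊗[R] H)).toLinearMap
      ∘ₗ LinearMap.lTensor H comul ∘ₗ comul)
    (fun h h' a => by
      simp only [map_add, LinearMap.add_comp, LinearMap.comp_add, LinearMap.lTensor_add,
        TensorProduct.map_add_right])
    (fun c h a => by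
      simp only [map_smul, LinearMap.smul_comp, LinearMap.comp_smul, LinearMap.lTensor_smul,
        TensorProduct.map_smul_right])
    (fun h a a' => by
      simp only [map_add, LinearMap.add_comp, LinearMap.comp_add, TensorProduct.map_add_left])
    (fun c h a => by
      simp only [map_smul, LinearMap.smul_comp, LinearMap.comp_smul, TensorProduct.map_smul_left]))

end Twisted

end HopfDuality

end

/-! Both algebras act faithfully as operators, and a linear bijection conjugates one set of
operators onto the other. Let `B` be `A #_σ H`, with `ι(a) = a # 1` and `γ(h) = 1 # h`. The algebra
`B # U` acts on `B` by `(b # f) c = ∑ f(c₁) b c₀` (`smashRep`). In the same way `(A ⊗ H) # U`, which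
is `A ⊗ (H # U)` up to associativity of the tensor product, acts on `A ⊗ H`, the crossed product
with trivial action and cocycle. The pivot is `γ̃(k) = ∑ σ'(k₂ ⊗ T(k₁)) γ(k₃)` (`gammaTilde`), the
two-sided inverse of `γ ∘ T` for the reversed convolution: `∑ γ̃(k₂) γ(T k₁) = ε(k) 1 = ∑ γ(T k₂)
γ̃(k₁)`. The coaction sends `γ̃(k)` to `∑ γ̃(k₁) ⊗ k₂`. Two things follow. First, `α(z)(k)` is
recovered from the operator of `z` as `∑ (z · γ̃(k₂)) γ(T k₁)`, so injectivity of `α` makes the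
action on `B` faithful. Second, `θ(a ⊗ k) = γ̃(k) ι(a)` is a colinear bijection from `A ⊗ H` to `B`.
Because `θ` is colinear, conjugation by it fixes the action of `U`. It turns left multiplication by
`ι(a) γ(h)` into `b ⊗ k ↦ ∑ φ(h₁ ⊗ a)(h₂ k₁) b ⊗ h₃ k₂` (`iota_mul_gamma_mul_gammaTilde`);
conjugation the other way produces `ψ` (`psi_apply_mul`). Such operators come from the smash product
once their coefficient functions lie in `J(A ⊗ V)`, because for `f ∈ V` the element `∑ f₋₁ # f₀`
acts on `H` as `k ↦ ∑ f(k₁) k₂`. The hypotheses on `φ` and `ψ` therefore give the two inclusions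
between the operator algebras, and faithfulness turns their equality into an isomorphism
(`exists_mulEquiv_of_conj`). For the second claim, `α` factors through `(A ⊗ H) ⊗ R^H`. The first
map is injective by purity and flatness of `H`, the second because `M ⊗ R^Λ → M^Λ` is injective over
a Noetherian ring. -/

namespace HopfDuality

open Coalgebra WithConv

-- Every Sweedler manipulation below requires linearity in each variable; as a `fun_prop` property
-- these side conditions are discharged automatically.
attribute [fun_prop] IsLinearMap

/-! ### Linearity of expressions, by `fun_prop` -/

section Linear

variable {R : Type*} [CommRing R] {X Y Z W : Type*}
  [AddCommGroup X] [Module R X] [AddCommGroup Y] [Module R Y]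
  [AddCommGroup Z] [Module R Z] [AddCommGroup W] [Module R W]

@[fun_prop]
theorem isLinearMap_id : IsLinearMap R (fun x : X => x) := ⟨fun _ _ => rfl, fun _ _ => rfl⟩

@[fun_prop]
theorem isLinearMap_comp {f : Y → Z} {g : X → Y} (hf : IsLinearMap R f) (hg : IsLinearMap R g) :
    IsLinearMap R (fun x => f (g x)) :=
  ⟨fun x y => by rw [hg.map_add, hf.map_add], fun c x => by rw [hg.map_smul, hf.map_smul]⟩

@[fun_prop]
theorem isLinearMap_coe (f : X →ₗ[R] Y) : IsLinearMap R (fun x => f x) := f.isLinear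

@[fun_prop]
theorem isLinearMap_op {f : X → Y} (hf : IsLinearMap R f) :
    IsLinearMap R (fun x => MulOpposite.op (f x)) :=
  ⟨fun _ _ => by rw [hf.map_add]; rfl, fun _ _ => by rw [hf.map_smul]; rfl⟩

@[fun_prop]
theorem isLinearMap_coe_left {f : X → Y →ₗ[R] Z} (hf : IsLinearMap R f) (y : Y) :
    IsLinearMap R (fun x => f x y) :=
  ⟨fun x y => by simp [hf.map_add], fun c x => by simp [hf.map_smul]⟩

@[fun_prop]
theorem isLinearMap_tmul_left (y : Y) : IsLinearMap R (fun x : X => x ⊗ₜ[R] y) :=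
  ⟨fun _ _ => TensorProduct.add_tmul .., fun _ _ => (TensorProduct.smul_tmul' ..).symm⟩

@[fun_prop]
theorem isLinearMap_tmul_right (x : X) : IsLinearMap R (fun y : Y => x ⊗ₜ[R] y) :=
  ⟨fun _ _ => TensorProduct.tmul_add .., fun _ _ => TensorProduct.tmul_smul ..⟩

@[fun_prop]
theorem isLinearMap_smul_left (y : Y) : IsLinearMap R (fun c : R => c • y) :=
  ⟨fun _ _ => add_smul .., fun _ _ => mul_smul ..⟩

@[fun_prop]
theorem isLinearMap_smul_right (c : R) : IsLinearMap R (fun y : Y => c • y) :=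
  ⟨fun _ _ => smul_add .., fun _ _ => smul_comm ..⟩

theorem exists_bilin {F : X → Y → Z} (h₁ : ∀ b, IsLinearMap R fun a => F a b)
    (h₂ : ∀ a, IsLinearMap R fun b => F a b) : ∃ f : X →ₗ[R] Y →ₗ[R] Z, ∀ a b, f a b = F a b :=
  ⟨LinearMap.mk₂ R F (fun a a' b => (h₁ b).map_add a a') (fun c a b => (h₁ b).map_smul c a)
    (fun a => (h₂ a).map_add) (fun c a b => (h₂ a).map_smul c b), fun _ _ => rfl⟩

variable {B : Type*} [NonUnitalNonAssocRing B] [Module R B] [SMulCommClass R B B]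
  [IsScalarTower R B B]

@[fun_prop]
theorem isLinearMap_mul_left (y : B) : IsLinearMap R (fun x : B => x * y) :=
  ⟨fun _ _ => add_mul .., fun _ _ => smul_mul_assoc ..⟩

@[fun_prop]
theorem isLinearMap_mul_right (x : B) : IsLinearMap R (fun y : B => x * y) :=
  ⟨fun _ _ => mul_add .., fun _ _ => mul_smul_comm ..⟩

end Linear

/-! ### Sweedler calculus in a coalgebra -/

section Sweedler

variable (R : Type*) [CommRing R] {C D X M N : Type*}
  [AddCommGroup C] [Module R C] [Coalgebra R C]
  [AddCommGroup D] [Module R D] [Coalgebra R D]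
  [AddCommGroup X] [Module R X] [AddCommGroup M] [Module R M] [AddCommGroup N] [Module R N]

/-- Sweedler notation: `sw R c F = ∑ F c₁ c₂`. -/
noncomputable def sw (c : C) (F : C → C → M) : M :=
  ∑ i ∈ (ℛ R c).index, F ((ℛ R c).left i) ((ℛ R c).right i)

variable {R}

theorem comul_eq_sw (c : C) : comul (R := R) c = sw R c fun a b => a ⊗ₜ[R] b := (ℛ R c).eq.symm

theorem isLinearMap_map_sw {G : M → N} (hG : IsLinearMap R G) (c : C) (F : C → C → M) :
    G (sw R c F) = sw R c fun a b => G (F a b) := map_sum (hG.mk' G) _ _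

theorem linearMap_map_sw (g : M →ₗ[R] N) (c : C) (F : C → C → M) :
    g (sw R c F) = sw R c fun a b => g (F a b) := map_sum g _ _

theorem linearEquiv_map_sw (g : M ≃ₗ[R] N) (c : C) (F : C → C → M) :
    g (sw R c F) = sw R c fun a b => g (F a b) := map_sum g _ _

theorem sw_linearMap_apply (c : C) (F : C → C → M →ₗ[R] N) (x : M) :
    sw R c F x = sw R c fun a b => F a b x := LinearMap.sum_apply ..

theorem smul_sw (r : R) (c : C) (F : C → C → M) :
    r • sw R c F = sw R c fun a b => r • F a b := Finset.smul_sum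

theorem tmul_sw (x : X) (c : C) (F : C → C → M) :
    x ⊗ₜ[R] sw R c F = sw R c fun a b => x ⊗ₜ[R] F a b := TensorProduct.tmul_sum ..

theorem sw_tmul_const (x : X) (c : C) (F : C → C → M) :
    sw R c F ⊗ₜ[R] x = sw R c fun a b => F a b ⊗ₜ[R] x := TensorProduct.sum_tmul ..

theorem mul_sw {B : Type*} [NonUnitalNonAssocRing B] (x : B) (c : C) (F : C → C → B) :
    x * sw R c F = sw R c fun a b => x * F a b := Finset.mul_sum ..

theorem sw_mul_const {B : Type*} [NonUnitalNonAssocRing B] (x : B) (c : C) (F : C → C → B) :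
    sw R c F * x = sw R c fun a b => F a b * x := Finset.sum_mul ..

theorem lift_comul (f : C →ₗ[R] C →ₗ[R] M) (c : C) :
    TensorProduct.lift f (comul c) = sw R c fun a b => f a b := by
  rw [comul_eq_sw, isLinearMap_map_sw (TensorProduct.lift f).isLinear]; rfl

@[fun_prop]
theorem isLinearMap_sw {F : C → C → M} (h₁ : ∀ b, IsLinearMap R fun a => F a b)
    (h₂ : ∀ a, IsLinearMap R fun b => F a b) : IsLinearMap R fun c => sw R c F := by
  obtain ⟨f, hf⟩ := exists_bilin h₁ h₂
  have : (fun c => sw R c F) = fun c => (TensorProduct.lift f ∘ₗ comul) c := by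
    ext c
    simp [lift_comul, hf]
  rw [this]
  fun_prop

@[fun_prop]
theorem isLinearMap_sw_fun {F : X → C → C → M} (c : C)
    (h : ∀ a b, IsLinearMap R fun x => F x a b) : IsLinearMap R fun x => sw R c (F x) :=
  ⟨fun x y => by simp only [sw, (h _ _).map_add, Finset.sum_add_distrib],
    fun r x => by simp only [sw, (h _ _).map_smul, Finset.smul_sum]⟩

/-- A bilinear `F` factors through the tensor product, so the sum does not depend on the
representation of `comul c` chosen in `sw`. -/
theorem sw_of_comul_eq {c : C} {ι : Type*} (s : Finset ι) (x y : ι → C)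
    (h : comul (R := R) c = ∑ i ∈ s, x i ⊗ₜ[R] y i) (F : C → C → M)
    (h₁ : ∀ b, IsLinearMap R fun a => F a b := by fun_prop)
    (h₂ : ∀ a, IsLinearMap R fun b => F a b := by fun_prop) :
    sw R c F = ∑ i ∈ s, F (x i) (y i) := by
  obtain ⟨f, hf⟩ := exists_bilin h₁ h₂
  have := congrArg (TensorProduct.lift f) h
  rw [lift_comul] at this
  simpa [hf] using this

theorem sw_coassoc (c : C) (F : C → C → C → M)
    (h₁ : ∀ a b, IsLinearMap R fun x => F x a b := by fun_prop)
    (h₂ : ∀ a b, IsLinearMap R fun x => F a x b := by fun_prop)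
    (h₃ : ∀ a b, IsLinearMap R fun x => F a b x := by fun_prop) :
    (sw R c fun x b => sw R x fun a a' => F a a' b) =
      sw R c fun a x => sw R x fun a' b => F a a' b := by
  have key : ∀ a, ∃ f : C →ₗ[R] C →ₗ[R] M, ∀ x y, f x y = F a x y := fun a =>
    exists_bilin (fun b => h₂ a b) (fun b => h₃ a b)
  choose f hf using key
  let g : C →ₗ[R] C ⊗[R] C →ₗ[R] M :=
    { toFun := fun a => TensorProduct.lift (f a)
      map_add' := fun a a' => by ext x y; simp [hf, (h₁ x y).map_add]
      map_smul' := fun r a => by ext x y; simp [hf, (h₁ x y).map_smul] }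
  have h := congrArg (TensorProduct.lift g) (Coalgebra.coassoc_apply (R := R) c)
  have e1 : TensorProduct.lift g (comul.lTensor C (comul c)) =
      sw R c fun a x => sw R x fun a' b => F a a' b := by
    rw [comul_eq_sw c]
    rw [isLinearMap_map_sw (G := fun t => TensorProduct.lift g (comul.lTensor C t)) (by fun_prop)]
    simp [g, lift_comul, hf]
  have e2 : TensorProduct.lift g (TensorProduct.assoc R C C C (comul.rTensor C (comul c))) =
      sw R c fun x b => sw R x fun a a' => F a a' b := by
    rw [comul_eq_sw c]
    rw [isLinearMap_map_sw (G := fun t => TensorProduct.lift g (TensorProduct.assoc R C C C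
      (comul.rTensor C t))) (by constructor <;> simp)]
    congr! with x b
    rw [LinearMap.rTensor_tmul, comul_eq_sw x,
      isLinearMap_map_sw (G := fun t => TensorProduct.lift g (TensorProduct.assoc R C C C
      (t ⊗ₜ b))) (by constructor <;> simp [TensorProduct.add_tmul, ← TensorProduct.smul_tmul'])]
    simp [g, hf]
  rw [← e2, h, e1]

theorem sw_counit_left (c : C) (F : C → M) (h : IsLinearMap R F := by fun_prop) :
    (sw R c fun a b => counit (R := R) a • F b) = F c := by
  have := Coalgebra.sum_counit_smul (R := R) (ℛ R c)
  conv_rhs => rw [← this]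
  simp only [sw, ← h.map_smul]
  exact (map_sum (h.mk' F) _ _).symm

theorem sw_counit_right (c : C) (F : C → M) (h : IsLinearMap R F := by fun_prop) :
    (sw R c fun a b => counit (R := R) b • F a) = F c := by
  have := congrArg (TensorProduct.lift (LinearMap.toSpanSingleton R _ (h.mk' F)).flip)
    (Coalgebra.sum_tmul_counit_eq (R := R) (ℛ R c))
  simp only [map_sum, TensorProduct.lift.tmul, LinearMap.flip_apply,
    LinearMap.toSpanSingleton_apply, IsLinearMap.mk'_apply, one_smul] at this
  exact this

/-- The primed forms carry plain linearity hypotheses instead of automatic ones, so that `simp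
(disch := fun_prop)` can rewrite with them. Used from left to right, this one brings iterated
coproducts to right-nested form. -/
theorem sw_coassoc' (c : C) (F : C → C → C → M)
    (h₁ : ∀ a b, IsLinearMap R fun x => F x a b) (h₂ : ∀ a b, IsLinearMap R fun x => F a x b)
    (h₃ : ∀ a b, IsLinearMap R fun x => F a b x) :
    (sw R c fun x b => sw R x fun a a' => F a a' b) =
      sw R c fun a x => sw R x fun a' b => F a a' b := sw_coassoc c F

theorem sw_counit_left' (c : C) (F : C → M) (h : IsLinearMap R F) :
    (sw R c fun a b => counit (R := R) a • F b) = F c := sw_counit_left c F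

theorem sw_counit_right' (c : C) (F : C → M) (h : IsLinearMap R F) :
    (sw R c fun a b => counit (R := R) b • F a) = F c := sw_counit_right c F

theorem sw_congr (c : C) {F G : C → C → M} (h : ∀ a b, F a b = G a b) : sw R c F = sw R c G :=
  congrArg _ (funext₂ h)

theorem sw_comm (c : C) (d : D) (F : C → C → D → D → M) :
    (sw R c fun a b => sw R d fun x y => F a b x y) =
      sw R d fun x y => sw R c fun a b => F a b x y := Finset.sum_comm

end Sweedler

/-! ### Sweedler calculus for products, tensor products and convolution -/

section Bialgebra

variable {R : Type*} [CommRing R] {H : Type*} [Ring H] [Bialgebra R H]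
  {M : Type*} [AddCommGroup M] [Module R M]

theorem sw_one (F : H → H → M)
    (h₁ : ∀ b, IsLinearMap R fun a => F a b := by fun_prop)
    (h₂ : ∀ a, IsLinearMap R fun b => F a b := by fun_prop) : sw R (1 : H) F = F 1 1 := by
  simpa using sw_of_comul_eq (R := R) (c := (1 : H)) {()} (fun _ => 1) (fun _ => 1)
    (by simp [Algebra.TensorProduct.one_def]) F h₁ h₂

theorem sw_one' (F : H → H → M) (h₁ : ∀ b, IsLinearMap R fun a => F a b)
    (h₂ : ∀ a, IsLinearMap R fun b => F a b) : sw R (1 : H) F = F 1 1 := sw_one F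

theorem sw_mul (h k : H) (F : H → H → M)
    (h₁ : ∀ b, IsLinearMap R fun a => F a b := by fun_prop)
    (h₂ : ∀ a, IsLinearMap R fun b => F a b := by fun_prop) :
    sw R (h * k) F = sw R h fun a b => sw R k fun x y => F (a * x) (b * y) := by
  rw [sw_of_comul_eq (R := R) (c := h * k) ((ℛ R h).index ×ˢ (ℛ R k).index)
    (fun i => (ℛ R h).left i.1 * (ℛ R k).left i.2)
    (fun i => (ℛ R h).right i.1 * (ℛ R k).right i.2) ?_ F h₁ h₂, Finset.sum_product]
  · rfl
  · rw [Bialgebra.comul_mul, ← (ℛ R h).eq, ← (ℛ R k).eq, Finset.sum_mul_sum,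
      Finset.sum_product]
    simp

theorem sw_mul' (h k : H) (F : H → H → M) (h₁ : ∀ b, IsLinearMap R fun a => F a b)
    (h₂ : ∀ a, IsLinearMap R fun b => F a b) :
    sw R (h * k) F = sw R h fun a b => sw R k fun x y => F (a * x) (b * y) := sw_mul h k F

theorem sw_tmul {C D : Type*} [AddCommGroup C] [Module R C] [Coalgebra R C]
    [AddCommGroup D] [Module R D] [Coalgebra R D] (h : C) (k : D) (F : C ⊗[R] D → C ⊗[R] D → M)
    (h₁ : ∀ b, IsLinearMap R fun a => F a b := by fun_prop)
    (h₂ : ∀ a, IsLinearMap R fun b => F a b := by fun_prop) :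
    sw R (h ⊗ₜ[R] k) F = sw R h fun a b => sw R k fun x y => F (a ⊗ₜ x) (b ⊗ₜ y) := by
  rw [sw_of_comul_eq (R := R) (c := h ⊗ₜ[R] k) ((ℛ R h).index ×ˢ (ℛ R k).index)
    (fun i => (ℛ R h).left i.1 ⊗ₜ (ℛ R k).left i.2)
    (fun i => (ℛ R h).right i.1 ⊗ₜ (ℛ R k).right i.2) ?_ F h₁ h₂, Finset.sum_product]
  · rfl
  · rw [TensorProduct.comul_tmul, ← (ℛ R h).eq, ← (ℛ R k).eq, Finset.sum_product]
    simp only [TensorProduct.tmul_sum, TensorProduct.sum_tmul,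
      TensorProduct.AlgebraTensorModule.tensorTensorTensorComm_tmul, map_sum]
    exact Finset.sum_comm

theorem conv_apply {C B : Type*} [AddCommGroup C] [Module R C] [Coalgebra R C]
    [Ring B] [Algebra R B] (f g : WithConv (C →ₗ[R] B)) (c : C) :
    (f * g).ofConv c = sw R c fun a b => f.ofConv a * g.ofConv b :=
  (ℛ R c).convMul_apply f g

theorem conv_tmul_apply {C D B : Type*} [AddCommGroup C] [Module R C] [Coalgebra R C]
    [AddCommGroup D] [Module R D] [Coalgebra R D] [Ring B] [Algebra R B]
    (f g : WithConv (C ⊗[R] D →ₗ[R] B)) (c : C) (d : D) :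
    (f * g).ofConv (c ⊗ₜ d) =
      sw R c fun a b => sw R d fun x y => f.ofConv (a ⊗ₜ x) * g.ofConv (b ⊗ₜ y) := by
  exact (conv_apply f g _).trans (sw_tmul c d (fun a b => f.ofConv a * g.ofConv b))

end Bialgebra

/-! ### Twisted antipodes reverse products and coproducts -/

section TwistedAntipode

variable {R : Type*} [CommRing R] {H : Type*} [Ring H] [Bialgebra R H]
  {M : Type*} [AddCommGroup M] [Module R M] {T : H →ₗ[R] H}

namespace IsTwistedAntipode

theorem sw_left (hT : IsTwistedAntipode T) (k : H) (G : H → M)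
    (hG : IsLinearMap R G := by fun_prop) :
    (sw R k fun a b => G (T b * a)) = counit (R := R) k • G 1 := by
  have h := LinearMap.congr_fun hT.mul_left k
  simp only [LinearMap.comp_apply, comul_eq_sw k] at h
  rw [← isLinearMap_map_sw hG, ← hG.map_smul]
  congr 1
  rw [← Algebra.algebraMap_eq_smul_one]
  refine Eq.trans ?_ h
  simp [sw]

theorem sw_right (hT : IsTwistedAntipode T) (k : H) (G : H → M)
    (hG : IsLinearMap R G := by fun_prop) :
    (sw R k fun a b => G (b * T a)) = counit (R := R) k • G 1 := by
  have h := LinearMap.congr_fun hT.mul_right k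
  simp only [LinearMap.comp_apply, comul_eq_sw k] at h
  rw [← isLinearMap_map_sw hG, ← hG.map_smul]
  congr 1
  rw [← Algebra.algebraMap_eq_smul_one]
  refine Eq.trans ?_ h
  simp [sw]

theorem apply_one (hT : IsTwistedAntipode T) : T 1 = 1 := by
  simpa [sw_one] using (sw_one (R := R) (fun a b : H => T b * a)).symm.trans
    (hT.sw_left 1 fun x => x)

theorem counit_apply (hT : IsTwistedAntipode T) (k : H) :
    counit (R := R) (T k) = counit (R := R) k := by
  have h := hT.sw_left k fun x => counit (R := R) x
  simp only [Bialgebra.counit_mul, Bialgebra.counit_one, smul_eq_mul, mul_one] at h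
  rw [← h, ← sw_counit_left (R := R) k fun x => counit (R := R) (T x)]
  exact sw_congr _ fun a b => mul_comm _ _

/-- A twisted antipode is antimultiplicative. -/
theorem apply_mul (hT : IsTwistedAntipode T) (h k : H) : T (h * k) = T k * T h := by
  -- A twisted antipode is an antipode for the opposite product, so the convolution takes values in
  -- `Hᵐᵒᵖ`. There `u` is a left inverse and `v` a right inverse of `m`, hence `u = v`.
  let op : H ≃ₗ[R] Hᵐᵒᵖ := MulOpposite.opLinearEquiv R
  let m : WithConv (H ⊗[R] H →ₗ[R] Hᵐᵒᵖ) := toConv (op.toLinearMap ∘ₗ LinearMap.mul' R H)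
  let u : WithConv (H ⊗[R] H →ₗ[R] Hᵐᵒᵖ) := toConv (op.toLinearMap ∘ₗ T ∘ₗ LinearMap.mul' R H)
  let v : WithConv (H ⊗[R] H →ₗ[R] Hᵐᵒᵖ) := toConv (op.toLinearMap ∘ₗ LinearMap.mul' R H ∘ₗ
    (TensorProduct.comm R H H).toLinearMap ∘ₗ TensorProduct.map T T)
  have h1 : u * m = 1 := by
    apply WithConv.ofConv_injective
    ext h k : 3
    change (u * m).ofConv (h ⊗ₜ k) = _
    rw [conv_tmul_apply]
    have := hT.sw_right (h * k) fun x => MulOpposite.op x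
    rw [sw_mul (R := R) h k fun a b => MulOpposite.op (b * T a)] at this
    refine this.trans ?_
    simp [Algebra.algebraMap_eq_smul_one, mul_comm]
  have h2 : m * v = 1 := by
    apply WithConv.ofConv_injective
    ext h k : 3
    change (m * v).ofConv (h ⊗ₜ k) = _
    rw [conv_tmul_apply]
    calc _ = sw R k fun x y => sw R h fun a b => MulOpposite.op (T y * (T b * a) * x) := by
          rw [sw_comm]
          simp [m, v, op, ← MulOpposite.op_mul, mul_assoc]
      _ = counit (R := R) h • sw R k fun x y => MulOpposite.op (T y * x) := by
          rw [smul_sw]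
          refine sw_congr _ fun x y => ?_
          rw [hT.sw_left h fun z => MulOpposite.op (T y * z * x), mul_one]
      _ = _ := by
          rw [hT.sw_left k fun z => MulOpposite.op z]
          simp [Algebra.algebraMap_eq_smul_one, smul_smul, mul_comm]
  have := LinearMap.congr_fun (congrArg WithConv.ofConv (left_inv_eq_right_inv h1 h2)) (h ⊗ₜ k)
  exact MulOpposite.op_injective (by simpa [u, v, op] using this)

/-- A twisted antipode is anticomultiplicative. -/
theorem comul_apply (hT : IsTwistedAntipode T) (k : H) :
    comul (R := R) (T k) = sw R k fun a b => T b ⊗ₜ[R] T a := by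
  -- Uniqueness of convolution inverses again, now for `comul` with values in the opposite algebra
  -- of `H ⊗ H`.
  let op : H ⊗[R] H ≃ₗ[R] (H ⊗[R] H)ᵐᵒᵖ := MulOpposite.opLinearEquiv R
  let m : WithConv (H →ₗ[R] (H ⊗[R] H)ᵐᵒᵖ) := toConv (op.toLinearMap ∘ₗ comul)
  let u : WithConv (H →ₗ[R] (H ⊗[R] H)ᵐᵒᵖ) := toConv (op.toLinearMap ∘ₗ comul ∘ₗ T)
  let v : WithConv (H →ₗ[R] (H ⊗[R] H)ᵐᵒᵖ) := toConv (op.toLinearMap ∘ₗ TensorProduct.map T T ∘ₗ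
    (TensorProduct.comm R H H).toLinearMap ∘ₗ comul)
  have hv : ∀ k, v.ofConv k = sw R k fun a b => MulOpposite.op (T b ⊗ₜ[R] T a) := fun k => by
    simp [v, op, comul_eq_sw k, sw]
  have h1 : u * m = 1 := by
    apply WithConv.ofConv_injective
    ext k : 1
    rw [conv_apply]
    have := hT.sw_right k fun x => MulOpposite.op (comul (R := R) x)
    simp only [Bialgebra.comul_mul] at this
    refine this.trans ?_
    simp [Algebra.algebraMap_eq_smul_one]
  have h2 : m * v = 1 := by
    apply WithConv.ofConv_injective
    ext k : 1
    rw [conv_apply]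
    calc _ = sw R k fun a b => sw R a fun a₁ a₂ => sw R b fun b₁ b₂ =>
            MulOpposite.op ((T b₂ * a₁) ⊗ₜ (T b₁ * a₂)) := by
          refine sw_congr _ fun a b => ?_
          have hm : m.ofConv a = sw R a fun a₁ a₂ => MulOpposite.op (a₁ ⊗ₜ[R] a₂) := by
            simp [m, op, comul_eq_sw a, sw]
          rw [hv, mul_sw, sw_comm, hm]
          refine sw_congr _ fun b₁ b₂ => ?_
          rw [sw_mul_const]
          refine sw_congr _ fun a₁ a₂ => ?_
          rw [← MulOpposite.op_mul, Algebra.TensorProduct.tmul_mul_tmul]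
      _ = sw R k fun a₁ x => sw R x fun y b₂ => sw R y fun a₂ b₁ => 
            MulOpposite.op ((T b₂ * a₁) ⊗ₜ (T b₁ * a₂)) := by
          rw [sw_coassoc k fun a₁ a₂ b => sw R b fun b₁ b₂ => MulOpposite.op ((T b₂ * a₁) ⊗ₜ (T b₁ * a₂))]
          refine sw_congr _ fun a₁ x => ?_
          rw [sw_coassoc x fun a₂ b₁ b₂ => MulOpposite.op ((T b₂ * a₁) ⊗ₜ (T b₁ * a₂))]
      _ = sw R k fun a₁ x => MulOpposite.op ((T x * a₁) ⊗ₜ 1) := by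
          refine sw_congr _ fun a₁ x => ?_
          rw [← sw_counit_left x fun b₂ => MulOpposite.op ((T b₂ * a₁) ⊗ₜ 1)]
          refine sw_congr _ fun y b₂ => ?_
          rw [hT.sw_left y fun z => MulOpposite.op ((T b₂ * a₁) ⊗ₜ z)]
      _ = _ := by
          rw [hT.sw_left k fun z => MulOpposite.op (z ⊗ₜ 1)]
          simp [Algebra.algebraMap_eq_smul_one, ← Algebra.TensorProduct.one_def]
  have := LinearMap.congr_fun (congrArg WithConv.ofConv (left_inv_eq_right_inv h1 h2)) k
  rw [hv, ← isLinearMap_map_sw (R := R) (G := MulOpposite.op) (by fun_prop)] at this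
  exact op.injective this

theorem sw_apply (hT : IsTwistedAntipode T) (k : H) (F : H → H → M)
    (h₁ : ∀ b, IsLinearMap R fun a => F a b := by fun_prop)
    (h₂ : ∀ a, IsLinearMap R fun b => F a b := by fun_prop) :
    sw R (T k) F = sw R k fun a b => F (T b) (T a) :=
  sw_of_comul_eq _ _ _ (hT.comul_apply k) F h₁ h₂

theorem sw_apply' (hT : IsTwistedAntipode T) (k : H) (F : H → H → M)
    (h₁ : ∀ b, IsLinearMap R fun a => F a b) (h₂ : ∀ a, IsLinearMap R fun b => F a b) :
    sw R (T k) F = sw R k fun a b => F (T b) (T a) := hT.sw_apply k F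

/-- `∑ F(T((h₂ k)₁) h₁, (h₂ k)₂) = ∑ F(T(k₁), h k₂)`. -/
theorem sw_contract (hT : IsTwistedAntipode T) (h k : H) (F : H → H → M)
    (h₁ : ∀ b, IsLinearMap R fun a => F a b := by fun_prop)
    (h₂ : ∀ a, IsLinearMap R fun b => F a b := by fun_prop) :
    (sw R h fun a b => sw R (b * k) fun x y => F (T x * a) y) =
      sw R k fun x y => F (T x) (h * y) := by
  -- Since `T` reverses products, `T(b₁ x) a = T(x) T(b₁) a`, and `T(b₁) a` collapses to a counit.
  calc _ = sw R h fun a b => sw R b fun b₁ b₂ => sw R k fun x y =>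
          F (T x * (T b₁ * a)) (b₂ * y) := by
        refine sw_congr _ fun a b => ?_
        rw [sw_mul b k fun x y => F (T x * a) y]
        simp only [hT.apply_mul, mul_assoc]
    _ = sw R h fun z b₂ => counit (R := R) z • sw R k fun x y => F (T x) (b₂ * y) := by
        rw [← sw_coassoc h fun a b₁ b₂ => sw R k fun x y => F (T x * (T b₁ * a)) (b₂ * y)]
        refine sw_congr _ fun z b₂ => ?_
        rw [hT.sw_left z fun t => sw R k fun x y => F (T x * t) (b₂ * y)]
        simp only [mul_one]
    _ = _ := sw_counit_left h fun b => sw R k fun x y => F (T x) (b * y)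

end IsTwistedAntipode

end TwistedAntipode

@[fun_prop]
theorem isLinearMap_algHom {R X Y : Type*} [CommRing R] [Ring X] [Algebra R X] [Ring Y]
    [Algebra R Y] (f : X →ₐ[R] Y) : IsLinearMap R (fun x => f x) := f.toLinearMap.isLinear

/-! ### Cleft extensions and the left inverse property of `γ̃` -/

section Cleft

variable {R : Type*} [CommRing R] {H : Type*} [Ring H] [Bialgebra R H]
  {A : Type*} [Ring A] [Algebra R A] {B : Type*} [Ring B] [Algebra R B]

theorem algHom_sw {C : Type*} [AddCommGroup C] [Module R C] [Coalgebra R C] (f : A →ₐ[R] B) (c : C)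
    (F : C → C → A) : f (sw R c F) = sw R c fun a b => f (F a b) := map_sum f _ _

/-- `B` is generated by a copy `ι` of `A` and a linear map `γ : H → B` which satisfy the
commutation rules of a crossed product. -/
structure IsCleft (act : H →ₗ[R] A →ₗ[R] A) (σ : H ⊗[R] H →ₗ[R] A) (ι : A →ₐ[R] B)
    (γ : H →ₗ[R] B) : Prop where
  gamma_one : γ 1 = 1
  gamma_mul_iota : ∀ h a, γ h * ι a = sw R h fun x y => ι (act x a) * γ y
  gamma_mul_gamma : ∀ h k,
    γ h * γ k = sw R h fun a b => sw R k fun x y => ι (σ (a ⊗ₜ x)) * γ (b * y)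

/-- `k ↦ ∑ σ'(k₂ ⊗ T(k₁))`. -/
noncomputable def cocycleInvDiag (T : H →ₗ[R] H) (σ' : H ⊗[R] H →ₗ[R] A) : H →ₗ[R] A :=
  IsLinearMap.mk' (fun k => sw R k fun a b => σ' (b ⊗ₜ T a)) (by fun_prop)

theorem cocycleInvDiag_apply (T : H →ₗ[R] H) (σ' : H ⊗[R] H →ₗ[R] A) (k : H) :
    cocycleInvDiag T σ' k = sw R k fun a b => σ' (b ⊗ₜ T a) := rfl

/-- `k ↦ ∑ σ'(k₂ ⊗ T(k₁)) γ(k₃)`. -/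
noncomputable def gammaTilde (T : H →ₗ[R] H) (σ' : H ⊗[R] H →ₗ[R] A) (ι : A →ₐ[R] B)
    (γ : H →ₗ[R] B) : H →ₗ[R] B :=
  IsLinearMap.mk' (fun k => sw R k fun a b => ι (cocycleInvDiag T σ' a) * γ b) (by fun_prop)

theorem gammaTilde_apply (T : H →ₗ[R] H) (σ' : H ⊗[R] H →ₗ[R] A) (ι : A →ₐ[R] B)
    (γ : H →ₗ[R] B) (k : H) :
    gammaTilde T σ' ι γ k = sw R k fun a b => ι (cocycleInvDiag T σ' a) * γ b := rfl

theorem phi_tmul (T : H →ₗ[R] H) (act : H →ₗ[R] A →ₗ[R] A) (σ : H ⊗[R] H →ₗ[R] A) (h : H) (a : A)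
    (k : H) : phi T act σ (h ⊗ₜ a) k = sw R k fun x y => act (T y) a * σ (T x ⊗ₜ h) := by
  simp [phi, comul_eq_sw k, sw]

theorem psiLeft_apply (T : H →ₗ[R] H) (act : H →ₗ[R] A →ₗ[R] A) (σ' : H ⊗[R] H →ₗ[R] A) (a : A)
    (k : H) : psiLeft T act σ' a k = sw R k fun x y => cocycleInvDiag T σ' x * act y a := by
  have h : ∀ x, σ' (LinearMap.lTensor H T (TensorProduct.comm R H H (comul x))) =
      cocycleInvDiag T σ' x := fun x => by
    simp [cocycleInvDiag_apply, comul_eq_sw x, sw]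
  simp [psiLeft, comul_eq_sw k, sw, h]

theorem psi_tmul (T : H →ₗ[R] H) (act : H →ₗ[R] A →ₗ[R] A) (σ σ' : H ⊗[R] H →ₗ[R] A) (h : H)
    (a : A) (k : H) : psi T act σ σ' (h ⊗ₜ a) k =
      sw R k fun x y => sw R y fun z w => psiLeft T act σ' a z * σ (w ⊗ₜ (T x * h)) := by
  simp only [psi, TensorProduct.lift.tmul, LinearMap.mk₂_apply, LinearMap.comp_apply]
  simp only [comul_eq_sw, linearMap_map_sw, LinearMap.lTensor_tmul, tmul_sw, LinearEquiv.coe_coe,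
    TensorProduct.comm_tmul, TensorProduct.assoc_tmul, TensorProduct.map_tmul, LinearMap.comp_apply,
    LinearMap.mul'_apply, LinearMap.flip_apply, LinearMap.mul_apply']

namespace IsConvInverse

variable {σ σ' : H ⊗[R] H →ₗ[R] A}

theorem inv_mul_tmul (hσ : IsConvInverse σ σ') (h k : H) :
    (sw R h fun a b => sw R k fun x y => σ' (a ⊗ₜ x) * σ (b ⊗ₜ y)) =
      (counit (R := R) h * counit (R := R) k) • 1 := by
  have := LinearMap.congr_fun (congrArg WithConv.ofConv hσ.inv_mul) (h ⊗ₜ k)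
  rw [conv_tmul_apply] at this
  refine this.trans ?_
  simp [Algebra.algebraMap_eq_smul_one, mul_comm]

theorem mul_inv_tmul (hσ : IsConvInverse σ σ') (h k : H) :
    (sw R h fun a b => sw R k fun x y => σ (a ⊗ₜ x) * σ' (b ⊗ₜ y)) =
      (counit (R := R) h * counit (R := R) k) • 1 := by
  have := LinearMap.congr_fun (congrArg WithConv.ofConv hσ.mul_inv) (h ⊗ₜ k)
  rw [conv_tmul_apply] at this
  refine this.trans ?_
  simp [Algebra.algebraMap_eq_smul_one, mul_comm]

/-- This is `σ' ⋆ σ = ε` at `k₂ ⊗ T(k₁)`: the coproduct of `T(k₁)` is reversed, which is why the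
arguments of `T` appear in the order `x`, `t`. -/
theorem inv_mul_diag (hσ : IsConvInverse σ σ') {T : H →ₗ[R] H} (hT : IsTwistedAntipode T) (k : H) :
    (sw R k fun z w => sw R z fun t x => sw R w fun y p => σ' (y ⊗ₜ T x) * σ (p ⊗ₜ T t)) =
      counit (R := R) k • 1 := by
  have h := fun z w => hσ.inv_mul_tmul w (T z)
  simp (disch := fun_prop) only [hT.sw_apply', hT.counit_apply, mul_smul] at h
  refine (sw_congr _ fun z w => (sw_comm ..).trans (h z w)).trans ?_
  exact sw_counit_right (R := R) k fun z => counit (R := R) z • (1 : A)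

end IsConvInverse

namespace IsCleft

variable {act : H →ₗ[R] A →ₗ[R] A} {σ σ' : H ⊗[R] H →ₗ[R] A} {ι : A →ₐ[R] B} {γ : H →ₗ[R] B}
  {T : H →ₗ[R] H}

/-- Expanding `γ(b) γ(T a)` by the cocycle rule puts `σ'` next to `σ`. These cancel by
`inv_mul_diag`, and what is left is `γ(∑ k₂ T(k₁))`. -/
theorem gammaTilde_mul_gamma (hB : IsCleft act σ ι γ) (hσ : IsConvInverse σ σ')
    (hT : IsTwistedAntipode T) (k : H) :
    (sw R k fun a b => gammaTilde T σ' ι γ b * γ (T a)) = counit (R := R) k • 1 := by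
  calc _ = sw R k fun a b => sw R a fun r t => sw R b fun b₁ b₂ => sw R b₁ fun x y =>
          sw R b₂ fun p q => ι (σ' (y ⊗ₜ T x) * σ (p ⊗ₜ T t)) * γ (q * T r) := by
        refine sw_congr _ fun a b => ?_
        simp only [gammaTilde_apply, sw_mul_const, cocycleInvDiag_apply, algHom_sw, mul_assoc,
          hB.gamma_mul_gamma, mul_sw]
        simp (disch := fun_prop) only [hT.sw_apply', sw_comm a, map_mul, mul_assoc]
    _ = sw R k fun r w => sw R w fun z q => sw R z fun X Y => sw R X fun t x => sw R Y fun y p => 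
          ι (σ' (y ⊗ₜ T x) * σ (p ⊗ₜ T t)) * γ (q * T r) := by
        simp (disch := fun_prop) only [sw_coassoc']
    _ = sw R k fun r w => sw R w fun z q => counit (R := R) z • γ (q * T r) := by
        refine sw_congr _ fun r w => sw_congr _ fun z q => ?_
        simp only [← sw_mul_const, ← algHom_sw, hσ.inv_mul_diag hT, map_smul, map_one,
          smul_mul_assoc, one_mul]
    _ = _ := by
        rw [← hB.gamma_one, ← hT.sw_right k fun x => γ x]
        exact sw_congr _ fun r w => sw_counit_left w fun q => γ (q * T r)

end IsCleft

end Cleft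

/-! ### Maps out of tensor products from multilinear formulas -/

section Multilinear

variable {R : Type*} [CommRing R] {X Y Z M : Type*}
  [AddCommGroup X] [Module R X] [AddCommGroup Y] [Module R Y]
  [AddCommGroup Z] [Module R Z] [AddCommGroup M] [Module R M]

theorem exists_lift (F : X → Y → M) (h₁ : ∀ y, IsLinearMap R fun x => F x y := by fun_prop)
    (h₂ : ∀ x, IsLinearMap R fun y => F x y := by fun_prop) :
    ∃ f : X ⊗[R] Y →ₗ[R] M, ∀ x y, f (x ⊗ₜ y) = F x y := by
  obtain ⟨f, hf⟩ := exists_bilin h₁ h₂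
  exact ⟨TensorProduct.lift f, fun x y => by simp [hf]⟩

theorem exists_lift_bilin (F : X → Y → Z → M)
    (h₁ : ∀ y z, IsLinearMap R fun x => F x y z := by fun_prop)
    (h₂ : ∀ x z, IsLinearMap R fun y => F x y z := by fun_prop)
    (h₃ : ∀ x y, IsLinearMap R fun z => F x y z := by fun_prop) :
    ∃ f : X ⊗[R] Y →ₗ[R] Z →ₗ[R] M, ∀ x y z, f (x ⊗ₜ y) z = F x y z := by
  obtain ⟨f, hf⟩ := exists_lift (R := R) (fun x y => (h₃ x y).mk' _)
    (fun y => ⟨fun a b => LinearMap.ext fun z => (h₁ y z).map_add a b,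
      fun c a => LinearMap.ext fun z => (h₁ y z).map_smul c a⟩)
    (fun x => ⟨fun a b => LinearMap.ext fun z => (h₂ x z).map_add a b,
      fun c a => LinearMap.ext fun z => (h₂ x z).map_smul c a⟩)
  exact ⟨f, fun x y z => by rw [hf]; rfl⟩

end Multilinear

/-! ### The other inverse property, and conjugation by `γ̃` -/

section Cleft

variable {R : Type*} [CommRing R] {H : Type*} [Ring H] [Bialgebra R H]
  {A : Type*} [Ring A] [Algebra R A] {B : Type*} [Ring B] [Algebra R B]

namespace IsCleft

variable {act : H →ₗ[R] A →ₗ[R] A} {σ σ' : H ⊗[R] H →ₗ[R] A} {ι : A →ₐ[R] B} {γ : H →ₗ[R] B}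
  {T : H →ₗ[R] H}

theorem gamma_mul_iota_mul_gamma (hB : IsCleft act σ ι γ)
    (hT : IsTwistedAntipode T) (h l : H) (a : A) :
    γ (T l) * ι a * γ h = sw R h fun h₁ h₂ => sw R l fun l₁ l₂ =>
      ι (phi T act σ (h₁ ⊗ₜ a) l₂) * γ (T l₁ * h₂) := by
  calc _ = sw R l fun x y => sw R x fun p q => sw R h fun h₁ h₂ =>
        ι (act (T y) a * σ (T q ⊗ₜ h₁)) * γ (T p * h₂) := by
        simp (disch := fun_prop) only [hB.gamma_mul_iota, hT.sw_apply', sw_mul_const, mul_assoc,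
          hB.gamma_mul_gamma, mul_sw, map_mul]
    _ = _ := by
        simp (disch := fun_prop) only [sw_coassoc', phi_tmul, algHom_sw, sw_mul_const, sw_comm h]

/-- Right multiplication by `γ ∘ T` can be cancelled. This is what upgrades the one-sided inverse
`γ̃` to a two-sided one, with no direct computation of `∑ γ(T k₂) γ̃(k₁)`. -/
theorem exists_gamma_cancel (hB : IsCleft act σ ι γ) (hσ : IsConvInverse σ σ')
    (hT : IsTwistedAntipode T)
    (hκ : Function.Bijective (TensorProduct.lift (LinearMap.mul R B |>.compl₁₂ ι.toLinearMap γ))) :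
    ∃ ν : B →ₗ[R] H →ₗ[R] B, ∀ b k,
      (sw R k fun x y => ν (b * γ (T y)) x) = counit (R := R) k • b := by
  let κ := LinearEquiv.ofBijective _ hκ
  have hκ_tmul : ∀ a l, κ (a ⊗ₜ l) = ι a * γ l := fun a l => by simp [κ]
  -- For group-like `l`, `k` the cocycle rule reads `γ(l k) γ(T k) = σ(l k ⊗ T k) γ(l)`, so `γ(l)
  -- γ(T k)⁻¹` has to be `σ'(l k ⊗ T k) γ(l k)`. The formula is the Sweedler form of this, made left
  -- `A`-linear.
  obtain ⟨f, hf⟩ := exists_lift_bilin (R := R) (fun (a : A) (l k : H) => sw R l fun l₁ l₂ =>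
    sw R k fun k₁ z => sw R z fun k₂ k₃ =>
      ι a * ι (σ' ((l₁ * k₂) ⊗ₜ T k₁)) * γ (l₂ * k₃))
  refine ⟨f ∘ₗ κ.symm.toLinearMap, fun b k => ?_⟩
  have hf' : ∀ a l k, f (κ.symm (ι a * γ l)) k = sw R l fun l₁ l₂ =>
      sw R k fun k₁ z => sw R z fun k₂ k₃ => ι a * ι (σ' ((l₁ * k₂) ⊗ₜ T k₁)) * γ (l₂ * k₃) := by
    intro a l k
    rw [← hκ_tmul, LinearEquiv.symm_apply_apply, hf]
  obtain ⟨z, rfl⟩ := κ.surjective b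
  induction z with
  | zero => simp [sw]
  | add z w hz hw =>
    simp only [LinearMap.comp_apply, LinearEquiv.coe_coe, map_add, add_mul, LinearMap.add_apply,
      smul_add] at hz hw ⊢
    rw [← hz, ← hw]
    simp [sw, Finset.sum_add_distrib]
  | tmul a l =>
    rw [hκ_tmul]
    simp only [LinearMap.comp_apply, LinearEquiv.coe_coe]
    calc _ = sw R k fun x y => sw R l fun l₁ l₂ => sw R y fun p q => sw R l₂ fun l₃ l₄ =>
            sw R p fun p₁ p₂ => sw R x fun x₁ w => sw R w fun x₂ x₃ =>
            ι (a * σ (l₁ ⊗ₜ T q)) * ι (σ' ((l₃ * (T p₂ * x₂)) ⊗ₜ T x₁)) *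
              γ (l₄ * (T p₁ * x₃)) := by
          refine sw_congr _ fun x y => ?_
          have e : ι a * γ l * γ (T y) = sw R l fun l₁ l₂ => sw R y fun p q =>
              ι (a * σ (l₁ ⊗ₜ T q)) * γ (l₂ * T p) := by
            simp (disch := fun_prop) only [mul_assoc, hB.gamma_mul_gamma, mul_sw, hT.sw_apply',
              map_mul]
          rw [e]
          simp (disch := fun_prop) only [linearMap_map_sw, linearEquiv_map_sw, sw_linearMap_apply,
            hf', sw_mul', hT.sw_apply', mul_assoc]
      _ = sw R l fun l₁ l₂ => sw R l₂ fun l₃ l₄ => sw R k fun x₁ w => sw R w fun w' q =>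
            sw R w' fun x₂ w'' => sw R w'' fun s p₂ => sw R s fun x₃ p₁ =>
              ι (a * σ (l₁ ⊗ₜ T q)) * ι (σ' ((l₃ * (T p₂ * x₂)) ⊗ₜ T x₁)) *
                γ (l₄ * (T p₁ * x₃)) := by
          rw [sw_comm k]
          refine sw_congr _ fun l₁ l₂ => ?_
          -- Naming the element whose sum moves outwards gives the commutation rule a direction and
          -- keeps `simp` from looping.
          simp only [sw_comm (d := l₂)]
          refine sw_congr _ fun l₃ l₄ => ?_
          trans sw R k fun x y => sw R x fun x₁ w => sw R w fun x₂ x₃ =>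
            sw R y fun p q => sw R p fun p₁ p₂ =>
            ι (a * σ (l₁ ⊗ₜ T q)) * ι (σ' ((l₃ * (T p₂ * x₂)) ⊗ₜ T x₁)) * γ (l₄ * (T p₁ * x₃))
          · refine sw_congr _ fun x y => ?_
            simp only [sw_comm (d := x)]
            refine sw_congr _ fun x₁ w => ?_
            simp only [sw_comm (d := w)]
          · simp (disch := fun_prop) only [sw_coassoc']
      _ = sw R l fun l₁ l₂ => sw R l₂ fun l₃ l₄ => sw R k fun x₁ q =>
              ι (a * σ (l₁ ⊗ₜ T q)) * ι (σ' (l₃ ⊗ₜ T x₁)) * γ l₄ := by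
          refine sw_congr _ fun l₁ l₂ => sw_congr _ fun l₃ l₄ => sw_congr _ fun x₁ w => ?_
          -- After the regrouping, `T(p₁) x₃` and then `T(p₂) x₂` are adjacent components in the
          -- order that the antipode identity needs; they collapse from the inside out.
          have e1 : ∀ q x₂ p₂ s, (sw R s fun x₃ p₁ =>
              ι (a * σ (l₁ ⊗ₜ T q)) * ι (σ' ((l₃ * (T p₂ * x₂)) ⊗ₜ T x₁)) *
                γ (l₄ * (T p₁ * x₃))) = counit (R := R) s •
              (ι (a * σ (l₁ ⊗ₜ T q)) * ι (σ' ((l₃ * (T p₂ * x₂)) ⊗ₜ T x₁)) * γ l₄) := by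
            intro q x₂ p₂ s
            rw [hT.sw_left s fun u => ι (a * σ (l₁ ⊗ₜ T q)) *
              ι (σ' ((l₃ * (T p₂ * x₂)) ⊗ₜ T x₁)) * γ (l₄ * u), mul_one]
          have e2 : ∀ q w', (sw R w' fun x₂ w'' =>
              (ι (a * σ (l₁ ⊗ₜ T q)) * ι (σ' ((l₃ * (T w'' * x₂)) ⊗ₜ T x₁)) * γ l₄)) =
              counit (R := R) w' • (ι (a * σ (l₁ ⊗ₜ T q)) * ι (σ' (l₃ ⊗ₜ T x₁)) * γ l₄) := by
            intro q w'
            rw [hT.sw_left w' fun u => ι (a * σ (l₁ ⊗ₜ T q)) *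
              ι (σ' ((l₃ * u) ⊗ₜ T x₁)) * γ l₄, mul_one]
          simp (disch := fun_prop) only [e1, sw_counit_left', e2]
      _ = _ := by
          -- What remains is `σ ⋆ σ' = ε` at `l ⊗ T(k)`. The left inverse property used `σ' ⋆ σ = ε`
          -- instead.
          have e (l : H) := hσ.mul_inv_tmul l (T k)
          simp (disch := fun_prop) only [hT.sw_apply', hT.counit_apply] at e
          rw [← sw_coassoc (R := R) l fun l₁ l₃ l₄ => sw R k fun x₁ q =>
              ι (a * σ (l₁ ⊗ₜ T q)) * ι (σ' (l₃ ⊗ₜ T x₁)) * γ l₄]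
          simp only [← map_mul, mul_assoc, ← sw_mul_const, ← algHom_sw, ← mul_sw, e]
          simp only [mul_smul, map_smul, mul_smul_comm, smul_mul_assoc, mul_one]
          rw [sw_counit_left (R := R) l fun l => counit (R := R) k • (ι a * γ l)]

/-- Let `P(k)` be the left-hand side. By the left inverse property `∑ P(z₂) γ(T z₁) = γ(T z)`, which
is also the value for `P = ε`; cancelling `γ ∘ T` by means of `ν` gives the claim. -/
theorem gamma_mul_gammaTilde (hB : IsCleft act σ ι γ) (hσ : IsConvInverse σ σ')
    (hT : IsTwistedAntipode T)
    (hκ : Function.Bijective (TensorProduct.lift (LinearMap.mul R B |>.compl₁₂ ι.toLinearMap γ)))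
    (k : H) : (sw R k fun a b => γ (T b) * gammaTilde T σ' ι γ a) = counit (R := R) k • 1 := by
  obtain ⟨ν, hν⟩ := hB.exists_gamma_cancel hσ hT hκ
  have hz : ∀ z, (sw R z fun y v => (sw R v fun a b => γ (T b) * gammaTilde T σ' ι γ a) * γ (T y)) =
      γ (T z) := by
    intro z
    calc _ = sw R z fun t b => sw R t fun y a => γ (T b) * (gammaTilde T σ' ι γ a * γ (T y)) := by
          simp (disch := fun_prop) only [sw_coassoc', sw_mul_const, mul_assoc]
      _ = _ := by
          simp (disch := fun_prop) only [← mul_sw, hB.gammaTilde_mul_gamma hσ hT, mul_smul_comm,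
            mul_one, sw_counit_left']
  calc _ = sw R k fun u v => sw R u fun x y =>
          ν ((sw R v fun a b => γ (T b) * gammaTilde T σ' ι γ a) * γ (T y)) x := by
        simp (disch := fun_prop) only [hν, sw_counit_left']
    _ = sw R k fun x z => ν (γ (T z)) x := by
        simp (disch := fun_prop) only [sw_coassoc']
        refine sw_congr _ fun x z => ?_
        rw [← hz z, linearMap_map_sw, sw_linearMap_apply]
    _ = _ := by simpa using hν 1 k

/-- The twisted conjugate of `a γ(h)`. -/
theorem iota_phi_apply_mul (hB : IsCleft act σ ι γ) (hσ : IsConvInverse σ σ')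
    (hT : IsTwistedAntipode T)
    (hκ : Function.Bijective (TensorProduct.lift (LinearMap.mul R B |>.compl₁₂ ι.toLinearMap γ)))
    (h k : H) (a : A) :
    (sw R h fun h₁ h₂ => ι (phi T act σ (h₁ ⊗ₜ a) (h₂ * k))) =
      sw R h fun h₁ h₂ => sw R k fun k₁ k₂ =>
        γ (T (h₂ * k₂)) * ι a * γ h₁ * gammaTilde T σ' ι γ k₁ := by
  symm
  calc _ = sw R h fun h₁ h₂ => sw R k fun k₁ k₂ => sw R h₁ fun x y => sw R (h₂ * k₂) fun p q =>
          ι (phi T act σ (x ⊗ₜ a) q) * γ (T p * y) * gammaTilde T σ' ι γ k₁ := by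
        simp only [hB.gamma_mul_iota_mul_gamma hT, sw_mul_const]
    _ = sw R k fun k₁ k₂ => sw R h fun x h' => sw R h' fun y z => sw R (z * k₂) fun p q =>
          ι (phi T act σ (x ⊗ₜ a) q) * γ (T p * y) * gammaTilde T σ' ι γ k₁ := by
        rw [sw_comm]
        simp (disch := fun_prop) only [sw_coassoc']
    _ = sw R k fun k₁ k₂ => sw R h fun x h' => sw R k₂ fun p q =>
          ι (phi T act σ (x ⊗ₜ a) (h' * q)) * γ (T p) * gammaTilde T σ' ι γ k₁ := by
        -- `sw_contract` removes the component `y` of `h` against `T(p)`, leaving `γ(T p)` to meet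
        -- its inverse `γ̃(k₁)`.
        refine sw_congr _ fun k₁ k₂ => sw_congr _ fun x h' => ?_
        rw [hT.sw_contract h' k₂ fun u v =>
          ι (phi T act σ (x ⊗ₜ a) v) * γ u * gammaTilde T σ' ι γ k₁]
    _ = sw R h fun x h' => sw R k fun t q => sw R t fun k₁ p =>
          ι (phi T act σ (x ⊗ₜ a) (h' * q)) * (γ (T p) * gammaTilde T σ' ι γ k₁) := by
        rw [sw_comm]
        simp (disch := fun_prop) only [sw_coassoc', mul_assoc]
    _ = _ := by
        simp (disch := fun_prop) only [← mul_sw, hB.gamma_mul_gammaTilde hσ hT hκ, mul_smul_comm,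
            mul_one, sw_counit_left']

/-- The formula for `φ` as a conjugate is multiplied on the left by `γ̃`, which cancels `γ ∘ T`. In
terms of `θ` it says how left multiplication by `ι(a) γ(h)` looks on `A ⊗ H`. -/
theorem iota_mul_gamma_mul_gammaTilde (hB : IsCleft act σ ι γ) (hσ : IsConvInverse σ σ')
    (hT : IsTwistedAntipode T)
    (hκ : Function.Bijective (TensorProduct.lift (LinearMap.mul R B |>.compl₁₂ ι.toLinearMap γ)))
    (h k : H) (a : A) :
    ι a * γ h * gammaTilde T σ' ι γ k = sw R h fun h₁ h' => sw R h' fun h₂ h₃ =>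
      sw R k fun k₁ k₂ => gammaTilde T σ' ι γ (h₃ * k₂) *
        ι (phi T act σ (h₁ ⊗ₜ a) (h₂ * k₁)) := by
  symm
  calc _ = sw R k fun k₁ k₂ => sw R h fun t h₃ => gammaTilde T σ' ι γ (h₃ * k₂) *
          sw R t fun h₁ h₂ => ι (phi T act σ (h₁ ⊗ₜ a) (h₂ * k₁)) := by
        rw [sw_comm]
        simp (disch := fun_prop) only [sw_coassoc', mul_sw, sw_comm (d := k)]
    _ = sw R k fun t k₃ => sw R h fun s h₃ => gammaTilde T σ' ι γ (h₃ * k₃) *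
          sw R s fun h₁ h₂ => sw R t fun k₁ k₂ =>
        γ (T (h₂ * k₂)) * ι a * γ h₁ * gammaTilde T σ' ι γ k₁ := by
        simp only [hB.iota_phi_apply_mul hσ hT hκ]
    _ = sw R h fun h₁ v => sw R k fun k₁ w => (sw R (v * w) fun p q =>
          gammaTilde T σ' ι γ q * γ (T p)) * (ι a * γ h₁ * gammaTilde T σ' ι γ k₁) := by
        trans sw R h fun s h₃ => sw R s fun h₁ h₂ => sw R k fun t k₃ => sw R t fun k₁ k₂ =>
          gammaTilde T σ' ι γ (h₃ * k₃) *
            (γ (T (h₂ * k₂)) * ι a * γ h₁ * gammaTilde T σ' ι γ k₁)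
        · rw [sw_comm]
          refine sw_congr _ fun s h₃ => ?_
          simp only [mul_sw, sw_comm (d := s)]
        · simp (disch := fun_prop) only [sw_coassoc', sw_mul', sw_mul_const, mul_assoc]
          refine sw_congr _ fun h₁ v => ?_
          simp only [sw_comm (d := v)]
    _ = _ := by
        simp only [hB.gammaTilde_mul_gamma hσ hT, Bialgebra.counit_mul, smul_mul_assoc, one_mul,
          mul_smul, ← smul_sw]
        simp (disch := fun_prop) only [sw_counit_right']

theorem gammaTilde_mul_iota (hB : IsCleft act σ ι γ) (v : H) (a : A) :
    gammaTilde T σ' ι γ v * ι a = sw R v fun m c => ι (psiLeft T act σ' a m) * γ c := by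
  simp (disch := fun_prop) only [gammaTilde_apply, psiLeft_apply, sw_mul_const, algHom_sw,
    sw_coassoc', mul_assoc, hB.gamma_mul_iota, mul_sw, map_mul]

/-- This explains the formula for `ψ`: it is the `A`-coefficient that arises when `γ̃(l₂) ι(a)
γ(T(l₁) h)` is rewritten with `ι` to the left of `γ`. -/
theorem gammaTilde_mul_iota_mul_gamma (hB : IsCleft act σ ι γ) (hT : IsTwistedAntipode T)
    (h l : H) (a : A) :
    (sw R l fun u v => gammaTilde T σ' ι γ v * ι a * γ (T u * h)) =
      sw R h fun h₁ h₂ => sw R l fun l₁ u => sw R u fun l₂ l₃ =>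
        ι (psi T act σ σ' (h₁ ⊗ₜ a) l₂) * γ (l₃ * (T l₁ * h₂)) := by
  calc _ = sw R h fun h₁ h₂ => sw R l fun u v => sw R u fun u₁ u₂ => sw R v fun m c =>
        sw R c fun c₁ c₂ => ι (psiLeft T act σ' a m * σ (c₁ ⊗ₜ (T u₂ * h₁))) *
          γ (c₂ * (T u₁ * h₂)) := by
        simp (disch := fun_prop) only [hB.gammaTilde_mul_iota, sw_mul_const, mul_assoc,
          hB.gamma_mul_gamma, sw_mul', hT.sw_apply', mul_sw, map_mul]
        simp only [sw_comm (d := h)]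
        refine sw_congr _ fun h₁ h₂ => sw_congr _ fun u v => ?_
        simp only [sw_comm (d := u)]
    _ = _ := by
        refine sw_congr _ fun h₁ h₂ => ?_
        simp (disch := fun_prop) only [sw_coassoc', psi_tmul, algHom_sw, sw_mul_const]

/-- Two uses of `sw_contract` around the previous identity: one creates the factor `T(u) x` on the
right-hand side, the other removes `T(l₁) h₂` from the expansion in `ψ`. -/
theorem psi_apply_mul (hB : IsCleft act σ ι γ) (hT : IsTwistedAntipode T) (h k : H) (a : A) :
    (sw R h fun h₁ v => sw R k fun k₁ w => sw R (v * w) fun p q =>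
      ι (psi T act σ σ' (h₁ ⊗ₜ a) p) * γ (q * T k₁)) =
      sw R k fun k₁ k₂ => gammaTilde T σ' ι γ (h * k₂) * ι a * γ (T k₁) := by
  symm
  calc _ = sw R h fun x y => sw R (y * k) fun u v =>
        gammaTilde T σ' ι γ v * ι a * γ (T u * x) :=
        (hT.sw_contract h k fun u v => gammaTilde T σ' ι γ v * ι a * γ u).symm
    _ = sw R h fun h₁ v => sw R v fun h₂ h₃ => sw R (h₃ * k) fun l₁ u => sw R u fun l₂ l₃ =>
        ι (psi T act σ σ' (h₁ ⊗ₜ a) l₂) * γ (l₃ * (T l₁ * h₂)) := by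
        simp (disch := fun_prop) only [hB.gammaTilde_mul_iota_mul_gamma hT, sw_coassoc']
    _ = _ := by
        refine sw_congr _ fun h₁ v => ?_
        rw [hT.sw_contract v k fun x u => sw R u fun l₂ l₃ =>
          ι (psi T act σ σ' (h₁ ⊗ₜ a) l₂) * γ (l₃ * x)]

end IsCleft

end Cleft

/-! ### Smash products acting on comodule algebras -/

section Smash

variable {R : Type*} [CommRing R] {H : Type*} [Ring H] [Bialgebra R H]
  {B : Type*} [Ring B] [Algebra R B]

/-- `ρ` makes `B` a right `H`-comodule algebra. -/
structure IsComoduleAlgebra (ρ : B →ₗ[R] B ⊗[R] H) : Prop where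
  coassoc : ∀ b, TensorProduct.assoc R B H H (ρ.rTensor H (ρ b)) = comul.lTensor B (ρ b)
  counit : ∀ b, counit.lTensor B (ρ b) = b ⊗ₜ[R] (1 : R)
  map_mul : ∀ b c, ρ (b * c) = ρ b * ρ c

variable (B) in
/-- `b ⊗ h ↦ f(h) b`. -/
noncomputable def evalRight : Module.Dual R H →ₗ[R] B ⊗[R] H →ₗ[R] B :=
  (alphaMap (LinearMap.id : Module.Dual R H →ₗ[R] (H →ₗ[R] R)) B).flip

@[simp]
theorem evalRight_tmul (f : Module.Dual R H) (b : B) (h : H) :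
    evalRight B f (b ⊗ₜ h) = f h • b := by
  simp [evalRight]

/-- The action `f · b = ∑ f(b₁) b₀` of `H^*` on a right comodule. -/
noncomputable def dualAct (ρ : B →ₗ[R] B ⊗[R] H) : Module.Dual R H →ₗ[R] B →ₗ[R] B :=
  (evalRight B).compl₂ ρ

theorem dualAct_apply (ρ : B →ₗ[R] B ⊗[R] H) (f : Module.Dual R H) (b : B) :
    dualAct ρ f b = evalRight B f (ρ b) := rfl

theorem dualAct_conv {ρ : B →ₗ[R] B ⊗[R] H} (hρ : IsComoduleAlgebra ρ) (f g : Module.Dual R H)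
    (b : B) : dualAct ρ (dualConv R H f g) b = dualAct ρ f (dualAct ρ g b) := by
  obtain ⟨K, hK⟩ := exists_lift (R := R)
    (fun (b : B) (t : H ⊗[R] H) => TensorProduct.dualDistrib R H H (f ⊗ₜ g) t • b)
  have h1 : ∀ s : B ⊗[R] H, evalRight B f (ρ (evalRight B g s)) =
      K (TensorProduct.assoc R B H H (ρ.rTensor H s)) := by
    intro s
    induction s with
    | zero => simp
    | add x y hx hy => simp only [map_add, hx, hy]
    | tmul b h =>
      rw [evalRight_tmul, LinearMap.rTensor_tmul, map_smul, map_smul]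
      generalize ρ b = t
      induction t with
      | zero => simp
      | add x y hx hy => simp only [map_add, smul_add, TensorProduct.add_tmul, hx, hy]
      | tmul c k => simp [hK, mul_smul, smul_comm (f k)]
  have h2 : ∀ s : B ⊗[R] H, evalRight B (dualConv R H f g) s = K (comul.lTensor B s) := by
    intro s
    induction s with
    | zero => simp
    | add x y hx hy => simp only [map_add, hx, hy]
    | tmul b h => rw [evalRight_tmul, LinearMap.lTensor_tmul, hK]; rfl
  rw [dualAct_apply, dualAct_apply, dualAct_apply, h1, h2, hρ.coassoc]

theorem dualAct_counit {ρ : B →ₗ[R] B ⊗[R] H} (hρ : IsComoduleAlgebra ρ) (b : B) :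
    dualAct ρ counit b = b := by
  have h : ∀ s : B ⊗[R] H, evalRight B counit s = TensorProduct.rid R B (counit.lTensor B s) := by
    intro s
    induction s with
    | zero => simp
    | add x y hx hy => simp only [map_add, hx, hy]
    | tmul b h => simp
  rw [dualAct_apply, h, hρ.counit]
  simp

theorem evalRight_tmul_mul (f : Module.Dual R H) (c : B) (h : H) (s : B ⊗[R] H) :
    evalRight B f (c ⊗ₜ h * s) = c * evalRight B (rightRegular R H f h) s := by
  induction s with
  | zero => simp
  | add x y hx hy => simp only [map_add, mul_add, hx, hy]
  | tmul b k => simp [rightRegular]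

/-- The representation of `B # U` on `B`, `(b # f) c = ∑ b c₀ f(c₁)`. -/
noncomputable def smashRep (ρ : B →ₗ[R] B ⊗[R] H) (U : RightModuleSubalgebra R H) :
    B ⊗[R] U.toSubmodule →ₗ[R] B →ₗ[R] B :=
  TensorProduct.lift (LinearMap.compl₁₂ (LinearMap.mul R (Module.End R B))
    (LinearMap.mul R B) (dualAct ρ ∘ₗ U.toSubmodule.subtype))

variable {ρ : B →ₗ[R] B ⊗[R] H} {U : RightModuleSubalgebra R H}

@[simp]
theorem smashRep_tmul (b : B) (f : U.toSubmodule) (c : B) :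
    smashRep ρ U (b ⊗ₜ f) c = b * dualAct ρ f c := rfl

/-- Multiplicativity of `ρ` gives `f · (d c) = ∑ d₀ ((f d₁) · c)`, and coassociativity turns
convolution into composition; together these produce the smash product rule. -/
theorem smashRep_mul (hρ : IsComoduleAlgebra ρ) (x y : SmashProduct ρ U) (c : B) :
    smashRep ρ U (x * y : SmashProduct ρ U) c = smashRep ρ U x (smashRep ρ U y c) := by
  rw [SmashProduct.mul_def]
  change B ⊗[R] U.toSubmodule at x y
  induction x with
  | zero => simp
  | add x x' hx hx' => simp only [TensorProduct.add_tmul, map_add, LinearMap.add_apply, hx, hx']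
  | tmul b f =>
    induction y with
    | zero => simp
    | add y y' hy hy' => simp only [TensorProduct.tmul_add, map_add, LinearMap.add_apply, hy, hy']
    | tmul d g =>
      rw [smashRep_tmul, smashRep_tmul, dualAct_apply ρ f, hρ.map_mul]
      simp only [SmashProduct.mul, LinearMap.comp_apply, LinearMap.lTensor_tmul,
        LinearMap.rTensor_tmul, LinearEquiv.coe_coe]
      generalize ρ d = t
      induction t with
      | zero => simp
      | add t t' ht ht' =>
        simp only [TensorProduct.tmul_add, TensorProduct.add_tmul, map_add, LinearMap.add_apply,
          ht, ht', add_mul, mul_add]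
      | tmul d' h =>
        simp only [TensorProduct.assoc_tmul, TensorProduct.tensorTensorTensorComm_tmul,
          TensorProduct.map_tmul, LinearMap.mul'_apply, smashRep_tmul, evalRight_tmul_mul,
          mul_assoc]
        rw [← dualAct_apply, ← dualAct_conv hρ]
        rfl

theorem smashRep_counit (hρ : IsComoduleAlgebra ρ)
    (hε : counit (R := R) (A := H) ∈ U.toSubmodule) (c : B) :
    smashRep ρ U (1 ⊗ₜ ⟨counit, hε⟩) c = c := by
  rw [smashRep_tmul, dualAct_counit hρ, one_mul]

theorem alphaMap_evalPairing_tmul {M : Type*} [AddCommGroup M] [Module R M]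
    (V : Submodule R (Module.Dual R H)) (m : M) (f : V) (k : H) :
    alphaMap (evalPairing V) M (m ⊗ₜ f) k = (f : Module.Dual R H) k • m := by
  simp [evalPairing]

theorem dualAct_of_sw {k : H} {b : B} {u : H → B} (h : ρ b = sw R k fun x y => u x ⊗ₜ[R] y)
    (f : Module.Dual R H) : dualAct ρ f b = sw R k fun x y => f y • u x := by
  rw [dualAct_apply, h, linearMap_map_sw]
  simp

/-- On an element whose coaction comes from the coproduct of some `k`, the operator of `z` depends
on `z` only through `α(z)`. -/
theorem smashRep_of_sw {k : H} {b : B} {u : H → B} (h : ρ b = sw R k fun x y => u x ⊗ₜ[R] y)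
    (z : B ⊗[R] U.toSubmodule) :
    smashRep ρ U z b = sw R k fun x y => alphaMap (evalPairing U.toSubmodule) B z y * u x := by
  induction z with
  | zero => simp [sw]
  | add z w hz hw =>
    simp only [map_add, LinearMap.add_apply, hz, hw, add_mul]
    simp [sw, Finset.sum_add_distrib]
  | tmul c f =>
    simp only [smashRep_tmul, dualAct_of_sw h, mul_sw, alphaMap_evalPairing_tmul]
    simp

/-- The preceding formula is inverted: `v` cancels `u`, so `α(z)` is read off from the operator of
`z`. This gives faithfulness, and also computes `α` when only the operator is known. -/
theorem alphaMap_eq_smashRep {u v : H →ₗ[R] B}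
    (hu : ∀ k, ρ (u k) = sw R k fun x y => u x ⊗ₜ[R] y)
    (huv : ∀ k, (sw R k fun x y => u y * v x) = counit (R := R) k • 1)
    (z : B ⊗[R] U.toSubmodule) (k : H) :
    alphaMap (evalPairing U.toSubmodule) B z k = sw R k fun x y => smashRep ρ U z (u y) * v x := by
  simp only [smashRep_of_sw (hu _), sw_mul_const]
  rw [← sw_coassoc (R := R) k fun x a b => alphaMap (evalPairing U.toSubmodule) B z b * u a * v x]
  simp (disch := fun_prop) only [mul_assoc, ← mul_sw, huv, mul_smul_comm, mul_one,
    sw_counit_left']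

theorem smashRep_injective {u v : H →ₗ[R] B}
    (hu : ∀ k, ρ (u k) = sw R k fun x y => u x ⊗ₜ[R] y)
    (huv : ∀ k, (sw R k fun x y => u y * v x) = counit (R := R) k • 1)
    (hα : Function.Injective (alphaMap (evalPairing U.toSubmodule) B)) :
    Function.Injective (smashRep ρ U) := by
  intro z w h
  apply hα
  ext k
  rw [alphaMap_eq_smashRep hu huv, alphaMap_eq_smashRep hu huv, h]

end Smash

/-- Two representations with the same image up to conjugation give isomorphic algebras. -/
theorem exists_mulEquiv_of_conj {R P Q M N : Type*} [CommRing R]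
    [NonUnitalNonAssocRing P] [Module R P] [NonUnitalNonAssocRing Q] [Module R Q]
    [AddCommGroup M] [Module R M] [AddCommGroup N] [Module R N]
    {p : P →ₗ[R] M →ₗ[R] M} {q : Q →ₗ[R] N →ₗ[R] N}
    (hp : Function.Injective p) (hq : Function.Injective q)
    (hpm : ∀ x y m, p (x * y) m = p x (p y m)) (hqm : ∀ x y n, q (x * y) n = q x (q y n))
    {θ : N →ₗ[R] M} (hθ : Function.Bijective θ)
    (h₁ : ∀ x, ∃ y, ∀ n, p x (θ n) = θ (q y n)) (h₂ : ∀ y, ∃ x, ∀ n, p x (θ n) = θ (q y n)) :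
    ∃ e : P ≃ₗ[R] Q, (∀ x y, e (x * y) = e x * e y) ∧ ∀ x n, p x (θ n) = θ (q (e x) n) := by
  -- Faithfulness of `q` makes the partner of `x` unique, so the chosen function is automatically
  -- linear and multiplicative.
  have huniq : ∀ y y', (∀ n, θ (q y n) = θ (q y' n)) → y = y' := fun y y' h =>
    hq (LinearMap.ext fun n => hθ.1 (h n))
  choose e he using h₁
  let E : P →ₗ[R] Q :=
    { toFun := e
      map_add' := fun x y => huniq _ _ fun n => by simp [← he]
      map_smul' := fun c x => huniq _ _ fun n => by simp [← he] }
  have hE : Function.Bijective E := by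
    constructor
    · intro x y h
      refine hp (LinearMap.ext fun m => ?_)
      obtain ⟨n, rfl⟩ := hθ.2 m
      rw [he, he]
      exact congrArg (fun t => θ (q t n)) h
    · intro y
      obtain ⟨x, hx⟩ := h₂ y
      exact ⟨x, huniq _ _ fun n => by rw [← hx, he]; rfl⟩
  refine ⟨LinearEquiv.ofBijective E hE, fun x y => huniq _ _ fun n => ?_, he⟩
  change θ (q (e (x * y)) n) = θ (q (e x * e y) n)
  rw [← he, hpm, he y, he x, hqm]

/-! ### The coaction on a cleft extension and the bijection `θ` -/

section CleftComodule

variable {R : Type*} [CommRing R] {H : Type*} [Ring H] [Bialgebra R H]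
  {A : Type*} [Ring A] [Algebra R A] {B : Type*} [Ring B] [Algebra R B]

/-- A cleft extension with its coaction: `B` is `A ⊗ H` via `a ⊗ h ↦ ι(a) γ(h)`, with coaction
`id ⊗ Δ`. -/
structure IsCleftComodule (act : H →ₗ[R] A →ₗ[R] A) (σ : H ⊗[R] H →ₗ[R] A) (ι : A →ₐ[R] B)
    (γ : H →ₗ[R] B) (ρ : B →ₗ[R] B ⊗[R] H) : Prop extends IsCleft act σ ι γ where
  bijective : Function.Bijective (TensorProduct.lift (LinearMap.mul R B |>.compl₁₂ ι.toLinearMap γ))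
  coaction : ∀ a h, ρ (ι a * γ h) = sw R h fun x y => (ι a * γ x) ⊗ₜ[R] y

namespace IsCleftComodule

variable {act : H →ₗ[R] A →ₗ[R] A} {σ σ' : H ⊗[R] H →ₗ[R] A} {ι : A →ₐ[R] B} {γ : H →ₗ[R] B}
  {ρ : B →ₗ[R] B ⊗[R] H} {T : H →ₗ[R] H}

theorem induction_on (hB : IsCleftComodule act σ ι γ ρ) {P : B → Prop} (b : B)
    (h0 : P 0) (hadd : ∀ b c, P b → P c → P (b + c)) (h : ∀ a h, P (ι a * γ h)) : P b := by
  obtain ⟨z, rfl⟩ := hB.bijective.2 b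
  induction z with
  | zero => simpa using h0
  | add x y hx hy => simpa using hadd _ _ hx hy
  | tmul a k => simpa using h a k

theorem coaction_gamma (hB : IsCleftComodule act σ ι γ ρ) (h : H) :
    ρ (γ h) = sw R h fun x y => γ x ⊗ₜ[R] y := by
  simpa using hB.coaction 1 h

theorem coaction_iota (hB : IsCleftComodule act σ ι γ ρ) (a : A) : ρ (ι a) = ι a ⊗ₜ 1 := by
  have := hB.coaction a 1
  rwa [hB.gamma_one, sw_one (R := R) fun x y => (ι a * γ x) ⊗ₜ[R] y, hB.gamma_one, mul_one] at this

theorem isComoduleAlgebra (hB : IsCleftComodule act σ ι γ ρ) : IsComoduleAlgebra ρ where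
  coassoc b := by
    induction b using hB.induction_on with
    | h0 => simp
    | hadd b c hb hc => simp only [map_add, hb, hc]
    | h a h =>
      simp only [hB.coaction, linearMap_map_sw, linearEquiv_map_sw, LinearMap.rTensor_tmul,
        LinearMap.lTensor_tmul, sw_tmul_const, TensorProduct.assoc_tmul, comul_eq_sw, tmul_sw]
      rw [sw_coassoc (R := R) h fun x y z => (ι a * γ x) ⊗ₜ[R] (y ⊗ₜ[R] z)]
  counit b := by
    induction b using hB.induction_on with
    | h0 => simp
    | hadd b c hb hc => simp only [map_add, hb, hc, TensorProduct.add_tmul]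
    | h a h =>
      simp only [hB.coaction, linearMap_map_sw, LinearMap.lTensor_tmul]
      rw [← sw_counit_right (R := R) h fun h => (ι a * γ h) ⊗ₜ[R] (1 : R)]
      refine sw_congr _ fun x y => ?_
      rw [← TensorProduct.tmul_smul, smul_eq_mul, mul_one]
  map_mul b c := by
    induction b using hB.induction_on with
    | h0 => simp
    | hadd b b' hb hb' => simp only [map_add, add_mul, hb, hb']
    | h a h =>
      induction c using hB.induction_on with
      | h0 => simp
      | hadd c c' hc hc' => simp only [map_add, mul_add, hc, hc']
      | h c k =>
        have e : ∀ h k, ι a * γ h * (ι c * γ k) = sw R h fun x y => sw R y fun y' z =>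
            sw R k fun p q => ι (a * act x c * σ (y' ⊗ₜ p)) * γ (z * q) := fun h k => by
          rw [mul_assoc, ← mul_assoc (γ h), hB.gamma_mul_iota]
          simp only [sw_mul_const, mul_assoc, hB.gamma_mul_gamma, mul_sw, map_mul]
        rw [e]
        simp only [hB.coaction, linearMap_map_sw, sw_mul_const, mul_sw,
          Algebra.TensorProduct.tmul_mul_tmul, e, sw_tmul_const]
        simp (disch := fun_prop) only [sw_mul', sw_coassoc', sw_comm k]

/-- Colinearity of `θ`: the image of `ι` is coinvariant, and `γ̃` differs from the colinear map `γ`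
only by coefficients from `A`. -/
theorem coaction_gammaTilde_mul_iota (hB : IsCleftComodule act σ ι γ ρ) (a : A) (k : H) :
    ρ (gammaTilde T σ' ι γ k * ι a) = sw R k fun x y => (gammaTilde T σ' ι γ x * ι a) ⊗ₜ[R] y := by
  rw [hB.isComoduleAlgebra.map_mul, hB.coaction_iota]
  simp (disch := fun_prop) only [gammaTilde_apply, linearMap_map_sw, hB.coaction, sw_coassoc',
    sw_mul_const, Algebra.TensorProduct.tmul_mul_tmul, mul_one, sw_tmul_const]

theorem gammaTilde_one (hB : IsCleftComodule act σ ι γ ρ) (hσ : IsConvInverse σ σ')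
    (hT : IsTwistedAntipode T) : gammaTilde T σ' ι γ 1 = 1 := by
  have := hB.gammaTilde_mul_gamma hσ hT 1
  rw [sw_one (R := R) fun a b => gammaTilde T σ' ι γ b * γ (T a)] at this
  simpa [hT.apply_one, hB.gamma_one] using this

/-- The isomorphism `A ⊗ H → B`, `a ⊗ k ↦ γ̃(k) ι(a)` of right `A`-modules. -/
noncomputable def theta (T : H →ₗ[R] H) (σ' : H ⊗[R] H →ₗ[R] A) (ι : A →ₐ[R] B)
    (γ : H →ₗ[R] B) : A ⊗[R] H →ₗ[R] B :=
  TensorProduct.lift ((LinearMap.mul R B).flip.compl₁₂ ι.toLinearMap (gammaTilde T σ' ι γ))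

@[simp]
theorem theta_tmul (a : A) (k : H) :
    theta T σ' ι γ (a ⊗ₜ k) = gammaTilde T σ' ι γ k * ι a := rfl

/-- At `k = 1` the conjugation formula, together with `γ̃(1) = 1`, writes `ι(a) γ(h)` as a sum of
products `γ̃(·) ι(·)`. -/
theorem theta_surjective (hB : IsCleftComodule act σ ι γ ρ) (hσ : IsConvInverse σ σ')
    (hT : IsTwistedAntipode T) : Function.Surjective (theta T σ' ι γ) := by
  rw [← LinearMap.range_eq_top, eq_top_iff]
  rintro b -
  induction b using hB.induction_on with
  | h0 => exact zero_mem _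
  | hadd b c hb hc => exact add_mem hb hc
  | h a h =>
    have := hB.iota_mul_gamma_mul_gammaTilde hσ hT hB.bijective h 1 a
    rw [hB.gammaTilde_one hσ hT, mul_one] at this
    rw [this]
    refine sum_mem fun i _ => sum_mem fun j _ => sum_mem fun l _ => ?_
    exact ⟨_ ⊗ₜ _, theta_tmul _ _⟩

theorem theta_injective (hB : IsCleftComodule act σ ι γ ρ) (hσ : IsConvInverse σ σ')
    (hT : IsTwistedAntipode T) : Function.Injective (theta T σ' ι γ) := by
  -- The retraction of `ι` sends `ι(a) γ(h)` to `ε(h) a`.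
  obtain ⟨r, hr⟩ : ∃ r : B →ₗ[R] A, ∀ a, r (ι a) = a := by
    refine ⟨(TensorProduct.rid R A).toLinearMap ∘ₗ counit.lTensor A ∘ₗ
      (LinearEquiv.ofBijective _ hB.bijective).symm.toLinearMap, fun a => ?_⟩
    have : (LinearEquiv.ofBijective _ hB.bijective) (a ⊗ₜ[R] (1 : H)) = ι a := by
      simp [hB.gamma_one]
    rw [← this]
    simp only [LinearMap.comp_apply, LinearEquiv.coe_coe, LinearEquiv.symm_apply_apply]
    simp
  obtain ⟨E, hE⟩ := exists_lift (R := R) fun (b : B) (h : H) => γ (T h) * b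
  -- The left inverse is `b ↦ ∑ r(γ(T b₁) b₀) ⊗ b₂`. On `γ̃(k) ι(a)` the factor `γ(T k₂) γ̃(k₁)`
  -- collapses and `a ⊗ k` remains.
  refine Function.LeftInverse.injective (g := LinearMap.rTensor H (r ∘ₗ E ∘ₗ ρ) ∘ₗ ρ) fun z => ?_
  induction z with
  | zero => simp
  | add x y hx hy => rw [map_add, map_add, hx, hy]
  | tmul a k =>
    rw [theta_tmul, LinearMap.comp_apply, hB.coaction_gammaTilde_mul_iota]
    simp only [linearMap_map_sw, LinearMap.rTensor_tmul, LinearMap.comp_apply,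
      hB.coaction_gammaTilde_mul_iota, hE, ← mul_assoc, ← sw_mul_const]
    simp only [hB.gamma_mul_gammaTilde hσ hT hB.bijective,
      smul_mul_assoc, one_mul, map_smul, hr, ← TensorProduct.smul_tmul']
    exact sw_counit_left (R := R) k fun k => a ⊗ₜ[R] k

end IsCleftComodule

end CleftComodule

/-! ### `A ⊗ H` as the trivial cleft extension -/

section Trivial

variable (R : Type*) [CommRing R] (H : Type*) [Ring H] [Bialgebra R H]
  (A : Type*) [Ring A] [Algebra R A]

/-- The coaction `id ⊗ Δ` on the algebra `A ⊗ H`. -/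
noncomputable def tensorCoaction : A ⊗[R] H →ₗ[R] (A ⊗[R] H) ⊗[R] H :=
  (TensorProduct.assoc R A H H).symm.toLinearMap ∘ₗ LinearMap.lTensor A comul

theorem tensorCoaction_tmul (a : A) (h : H) :
    tensorCoaction R H A (a ⊗ₜ h) = sw R h fun x y => (a ⊗ₜ[R] x) ⊗ₜ[R] y := by
  simp [tensorCoaction, comul_eq_sw h, tmul_sw, linearEquiv_map_sw]

/-- The algebra `A ⊗ H` is the crossed product with trivial action and trivial cocycle. -/
theorem isCleftComodule_tensor :
    IsCleftComodule ((counit (R := R) (A := H)).smulRight (LinearMap.id : A →ₗ[R] A))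
      (Algebra.linearMap R A ∘ₗ counit (A := H ⊗[R] H))
      (Algebra.TensorProduct.includeLeft : A →ₐ[R] A ⊗[R] H)
      (Algebra.TensorProduct.includeRight : H →ₐ[R] A ⊗[R] H).toLinearMap
      (tensorCoaction R H A) where
  gamma_one := rfl
  gamma_mul_iota h a := by
    conv_lhs => rw [← sw_counit_left (R := R) h fun h => h]
    simp [sw, Finset.sum_mul, TensorProduct.smul_tmul']
  gamma_mul_gamma h k := by
    have e : ∀ a b x y : H, (Algebra.TensorProduct.includeLeft : A →ₐ[R] A ⊗[R] H)
        ((Algebra.linearMap R A ∘ₗ counit (A := H ⊗[R] H)) (a ⊗ₜ x)) *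
        (1 : A) ⊗ₜ[R] (b * y) =
        counit (R := R) a • counit (R := R) x • (1 : A) ⊗ₜ[R] (b * y) := fun a b x y => by
      simp [Algebra.algebraMap_eq_smul_one, TensorProduct.smul_tmul', smul_smul, mul_comm]
    simp only [AlgHom.toLinearMap_apply, Algebra.TensorProduct.includeRight_apply, e, ← smul_sw]
    simp (disch := fun_prop) only [sw_counit_left']
    simp
  bijective := by
    have : TensorProduct.lift ((LinearMap.mul R (A ⊗[R] H)).compl₁₂
        (Algebra.TensorProduct.includeLeft : A →ₐ[R] A ⊗[R] H).toLinearMap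
        (Algebra.TensorProduct.includeRight : H →ₐ[R] A ⊗[R] H).toLinearMap) = LinearMap.id := by
      ext; simp
    rw [this]
    exact Function.bijective_id
  coaction a h := by
    simp [tensorCoaction_tmul]

end Trivial

/-! ### The submodule `V = υ⁻¹(H ⊗ U)` made explicit -/

section Rational

variable {R : Type u} [CommRing R] {H : Type v} [Ring H] [Bialgebra R H]

theorem IsLocallyProjective.ext_dual {W : Type v} [AddCommGroup W] [Module R W]
    (hW : IsLocallyProjective R W) {x y : W} (h : ∀ g : Module.Dual R W, g x = g y) : x = y := by
  have : (1 : R) ⊗ₜ[R] x = 1 ⊗ₜ y := hW R (by ext g; simp [h g])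
  simpa using congrArg (TensorProduct.lid R W) this

variable {T : H →ₗ[R] H}

theorem twistedAction_apply (f g : Module.Dual R H) (l : H) :
    twistedAction T f g l = sw R l fun l₁ u => sw R u fun l₂ l₃ => g (l₃ * T l₁) * f l₂ := by
  simp only [twistedAction, twistedCoadjoint, LinearMap.flip_apply, TensorProduct.curry_apply,
    LinearMap.comp_apply, LinearMap.dualMap_apply, comul_eq_sw, linearMap_map_sw,
    LinearMap.lTensor_tmul, tmul_sw, LinearEquiv.coe_coe, TensorProduct.comm_tmul,
    TensorProduct.assoc_tmul, TensorProduct.dualDistrib_apply, LinearMap.mul'_apply]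

/-- Local projectivity with `M = R` shows that `H^*` separates the points of `H`. The defining
property of `υ`, stated for each functional `g`, thus becomes the identity `∑ f₀(l) f₋₁ = ∑ f(l₂) l₃
T(l₁)` in `H`. -/
theorem exists_of_mem_upsilonPreimage (hH : IsLocallyProjective R H)
    {U : Submodule R (Module.Dual R H)} {f : Module.Dual R H} (hf : f ∈ upsilonPreimage T hH U) :
    ∃ t : H ⊗[R] U, ∀ l, alphaMap (evalPairing U) H t l =
      sw R l fun l₁ u => sw R u fun l₂ l₃ => f l₂ • (l₃ * T l₁) := by
  obtain ⟨f, ⟨t, ht⟩, rfl⟩ := hf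
  refine ⟨t, fun l => hH.ext_dual fun g => ?_⟩
  have h1 : ∀ t : H ⊗[R] U, ratMap R H (TensorProduct.comm R H _ (U.subtype.lTensor H t)) g l =
      g (alphaMap (evalPairing U) H t l) := by
    intro t
    induction t with
    | zero => simp
    | add x y hx hy => simp only [map_add, LinearMap.add_apply, hx, hy]
    | tmul h u => simp [ratMap, evalPairing, mul_comm]
  rw [← h1, ht, ratMap_upsilon, twistedAction_apply]
  simp [linearMap_map_sw, mul_comm]

end Rational

/-! ### The operator algebras correspond under `θ` -/

section Duality

variable {R : Type u} [CommRing R] {H : Type v} [Ring H] [Bialgebra R H]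
  {A : Type w} [Ring A] [Algebra R A] {B : Type*} [Ring B] [Algebra R B]
  {T : H →ₗ[R] H} {U : RightModuleSubalgebra R H}

/-- For `C = f(·) a` with `f ∈ V`, the element is `∑ (a ⊗ f₋₁) # f₀`. It sends `b ⊗ k` to `∑ f(k₃)
ab ⊗ k₄ T(k₂) k₁`, and `T(k₂) k₁` collapses. -/
theorem exists_smashRep_tensor (hH : IsLocallyProjective R H) (hT : IsTwistedAntipode T)
    {C : H →ₗ[R] A}
    (hC : C ∈ LinearMap.range (alphaMap (evalPairing (upsilonPreimage T hH U.toSubmodule)) A)) :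
    ∃ w, ∀ b k, smashRep (tensorCoaction R H A) U w (b ⊗ₜ k) =
      sw R k fun x y => (C x * b) ⊗ₜ[R] y := by
  obtain ⟨z, rfl⟩ := hC
  induction z with
  | zero => exact ⟨0, fun b k => by simp [sw]⟩
  | add z z' hz hz' =>
    obtain ⟨w, hw⟩ := hz
    obtain ⟨w', hw'⟩ := hz'
    refine ⟨w + w', fun b k => ?_⟩
    rw [map_add, LinearMap.add_apply, hw, hw', map_add]
    simp [sw, add_mul, TensorProduct.add_tmul, Finset.sum_add_distrib]
  | tmul a f =>
    obtain ⟨t, ht⟩ := exists_of_mem_upsilonPreimage hH f.2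
    refine ⟨(TensorProduct.assoc R A H U.toSubmodule).symm (a ⊗ₜ t), fun b k => ?_⟩
    have h1 : ∀ (t : H ⊗[R] U.toSubmodule) (y : H), alphaMap (evalPairing U.toSubmodule) (A ⊗[R] H)
        ((TensorProduct.assoc R A H U.toSubmodule).symm (a ⊗ₜ t)) y =
        a ⊗ₜ alphaMap (evalPairing U.toSubmodule) H t y := by
      intro t y
      induction t with
      | zero => simp
      | add t t' ht ht' =>
        simp only [TensorProduct.tmul_add, map_add, LinearMap.add_apply, ht, ht']
      | tmul h u => simp
    rw [smashRep_of_sw (tensorCoaction_tmul R H A b k)]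
    simp only [h1, ht, tmul_sw, sw_mul_const, Algebra.TensorProduct.tmul_mul_tmul,
      alphaMap_evalPairing_tmul]
    calc _ = sw R k fun z u => sw R z fun x l₁ => sw R u fun l₂ l₃ =>
            (f : Module.Dual R H) l₂ • ((a * b) ⊗ₜ[R] (l₃ * (T l₁ * x))) := by
          simp (disch := fun_prop) only [sw_coassoc', smul_mul_assoc, TensorProduct.tmul_smul,
            mul_assoc]
      _ = sw R k fun z u => counit (R := R) z • sw R u fun l₂ l₃ =>
            (f : Module.Dual R H) l₂ • ((a * b) ⊗ₜ[R] l₃) := by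
          refine sw_congr _ fun z u => ?_
          rw [hT.sw_left z fun t => sw R u fun l₂ l₃ =>
            (f : Module.Dual R H) l₂ • ((a * b) ⊗ₜ[R] (l₃ * t))]
          simp only [mul_one]
      _ = _ := by
          simp (disch := fun_prop) only [sw_counit_left', TensorProduct.smul_tmul', smul_mul_assoc]

/-- This is the common shape of the operators from `φ` and from `ψ`: first `(1 ⊗ h₂) # f`, then the
operator with coefficient function `C h₁`. -/
theorem exists_smashRep_sw (hH : IsLocallyProjective R H) (hT : IsTwistedAntipode T)
    {C : H → H →ₗ[R] A}
    (hC : ∀ h, C h ∈ LinearMap.range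
      (alphaMap (evalPairing (upsilonPreimage T hH U.toSubmodule)) A))
    (h : H) (f : U.toSubmodule) :
    ∃ w, ∀ b k, smashRep (tensorCoaction R H A) U w (b ⊗ₜ k) =
      sw R h fun h₁ h₂ => sw R k fun k₁ k₂ => (f : Module.Dual R H) k₂ •
        sw R (h₂ * k₁) fun x y => (C h₁ x * b) ⊗ₜ[R] y := by
  have hN := (isCleftComodule_tensor R H A).isComoduleAlgebra
  have hw := fun h => exists_smashRep_tensor hH hT (hC h)
  choose w hw using hw
  have hm : ∀ h₁ h₂, ∃ y, ∀ n, smashRep (tensorCoaction R H A) U y n =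
      smashRep (tensorCoaction R H A) U (w h₁)
        (smashRep (tensorCoaction R H A) U (((1 : A) ⊗ₜ h₂) ⊗ₜ f) n) := fun h₁ h₂ =>
    ⟨_, smashRep_mul hN (w h₁) (SmashProduct.mk (tensorCoaction R H A) U ((1 : A) ⊗ₜ h₂) f)⟩
  choose y hy using hm
  refine ⟨sw R h y, fun b k => ?_⟩
  simp only [linearMap_map_sw, sw_linearMap_apply, hy, smashRep_tmul,
    dualAct_of_sw (tensorCoaction_tmul R H A b k), mul_sw, mul_smul_comm,
    Algebra.TensorProduct.tmul_mul_tmul, one_mul, map_smul, hw]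

variable {act : H →ₗ[R] A →ₗ[R] A} {σ σ' : H ⊗[R] H →ₗ[R] A} {ι : A →ₐ[R] B} {γ : H →ₗ[R] B}
  {ρ : B →ₗ[R] B ⊗[R] H}

open IsCleftComodule

theorem exists_smashRep_theta (hB : IsCleftComodule act σ ι γ ρ) (hσ : IsConvInverse σ σ')
    (hH : IsLocallyProjective R H) (hT : IsTwistedAntipode T)
    (hφ : LinearMap.range (phi T act σ) ≤
      LinearMap.range (alphaMap (evalPairing (upsilonPreimage T hH U.toSubmodule)) A))
    (x : B ⊗[R] U.toSubmodule) :
    ∃ y, ∀ n, smashRep ρ U x (theta T σ' ι γ n) =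
      theta T σ' ι γ (smashRep (tensorCoaction R H A) U y n) := by
  induction x with
  | zero => exact ⟨0, by simp⟩
  | add x x' hx hx' =>
    obtain ⟨y, hy⟩ := hx
    obtain ⟨y', hy'⟩ := hx'
    exact ⟨y + y', fun n => by simp [hy, hy']⟩
  | tmul b f =>
    induction b using hB.induction_on with
    | h0 => exact ⟨0, by simp⟩
    | hadd x x' hx hx' =>
      obtain ⟨y, hy⟩ := hx
      obtain ⟨y', hy'⟩ := hx'
      exact ⟨y + y', fun n => by
        rw [TensorProduct.add_tmul]; simp only [map_add, LinearMap.add_apply, hy, hy']⟩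
    | h a h =>
      obtain ⟨y, hy⟩ := exists_smashRep_sw hH hT (C := fun h => phi T act σ (h ⊗ₜ a))
        (fun h => hφ ⟨h ⊗ₜ a, rfl⟩) h f
      refine ⟨y, fun n => ?_⟩
      induction n with
      | zero => simp
      | add n n' hn hn' => simp only [map_add, hn, hn']
      | tmul b k =>
        have e : ∀ k₁, (sw R h fun h₁ h₂ => sw R (h₂ * k₁) fun x y =>
            gammaTilde T σ' ι γ y * (ι (phi T act σ (h₁ ⊗ₜ a) x) * ι b)) =
            ι a * γ h * (gammaTilde T σ' ι γ k₁ * ι b) := fun k₁ => by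
          rw [← mul_assoc, hB.iota_mul_gamma_mul_gammaTilde hσ hT hB.bijective]
          simp (disch := fun_prop) only [sw_mul_const, mul_assoc, sw_mul']
        rw [hy, smashRep_tmul, theta_tmul,
          dualAct_of_sw (hB.coaction_gammaTilde_mul_iota b k), sw_comm, linearMap_map_sw, mul_sw]
        refine sw_congr _ fun k₁ k₂ => ?_
        rw [← smul_sw, map_smul, mul_smul_comm, ← e]
        simp only [linearMap_map_sw, theta_tmul, map_mul]

theorem exists_theta_smashRep (hB : IsCleftComodule act σ ι γ ρ) (hσ : IsConvInverse σ σ')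
    (hH : IsLocallyProjective R H) (hT : IsTwistedAntipode T)
    (hψ : LinearMap.range (psi T act σ σ') ≤
      LinearMap.range (alphaMap (evalPairing (upsilonPreimage T hH U.toSubmodule)) A))
    (y : (A ⊗[R] H) ⊗[R] U.toSubmodule) :
    ∃ x, ∀ n, smashRep ρ U x (theta T σ' ι γ n) =
      theta T σ' ι γ (smashRep (tensorCoaction R H A) U y n) := by
  induction y with
  | zero => exact ⟨0, by simp⟩
  | add y y' hy hy' =>
    obtain ⟨x, hx⟩ := hy
    obtain ⟨x', hx'⟩ := hy'
    exact ⟨x + x', fun n => by simp only [map_add, LinearMap.add_apply, hx, hx']⟩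
  | tmul n f =>
    induction n with
    | zero => exact ⟨0, by simp⟩
    | add y y' hy hy' =>
      obtain ⟨x, hx⟩ := hy
      obtain ⟨x', hx'⟩ := hy'
      exact ⟨x + x', fun n => by
        rw [TensorProduct.add_tmul]; simp only [map_add, LinearMap.add_apply, hx, hx']⟩
    | tmul a h =>
      obtain ⟨w, hw⟩ := exists_smashRep_sw hH hT (C := fun h => psi T act σ σ' (h ⊗ₜ a))
        (fun h => hψ ⟨h ⊗ₜ a, rfl⟩) h f
      -- The required element of `B # U` is `w` carried over by `κ ⊗ id`. As `κ` is not
      -- multiplicative in general, its operator is found through `α`, which commutes with `κ`.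
      let κ := TensorProduct.lift (LinearMap.mul R B |>.compl₁₂ ι.toLinearMap γ)
      have hκ_tmul : ∀ a h, κ (a ⊗ₜ h) = ι a * γ h := fun a h => rfl
      have hκ : ∀ (w : (A ⊗[R] H) ⊗[R] U.toSubmodule) k,
          alphaMap (evalPairing U.toSubmodule) B (κ.rTensor _ w) k =
            κ (alphaMap (evalPairing U.toSubmodule) (A ⊗[R] H) w k) := by
        intro w k
        induction w with
        | zero => simp
        | add x y hx hy => simp only [map_add, LinearMap.add_apply, hx, hy]
        | tmul n u => simp only [LinearMap.rTensor_tmul, alphaMap_evalPairing_tmul, map_smul]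
      have hα : ∀ k, alphaMap (evalPairing U.toSubmodule) B (κ.rTensor _ w) k =
          sw R k fun k' k₂ => (f : Module.Dual R H) k₂ • sw R k' fun x k₁ =>
            gammaTilde T σ' ι γ (h * k₁) * ι a * γ (T x) := by
        intro k
        rw [hκ, alphaMap_eq_smashRep
          (u := (Algebra.TensorProduct.includeRight : H →ₐ[R] A ⊗[R] H).toLinearMap)
          (v := (Algebra.TensorProduct.includeRight : H →ₐ[R] A ⊗[R] H).toLinearMap ∘ₗ T)
          (isCleftComodule_tensor R H A).coaction_gamma]
        · simp only [← hB.psi_apply_mul hT]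
          simp only [AlgHom.toLinearMap_apply, Algebra.TensorProduct.includeRight_apply, hw,
            LinearMap.comp_apply, sw_mul_const, smul_mul_assoc, linearMap_map_sw, map_smul,
            Algebra.TensorProduct.tmul_mul_tmul, mul_one, hκ_tmul]
          trans sw R h fun h₁ h₂ => sw R k fun x y => sw R y fun k₁ k₂ =>
            (f : Module.Dual R H) k₂ • sw R (h₂ * k₁) fun p q =>
              ι (psi T act σ σ' (h₁ ⊗ₜ a) p) * γ (q * T x)
          · simp only [sw_comm (d := h)]
          · simp only [smul_sw]
            simp only [sw_comm (d := h)]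
            refine sw_congr _ fun h₁ h₂ => ?_
            simp (disch := fun_prop) only [sw_coassoc']
        · intro k
          simpa [Algebra.TensorProduct.one_def] using hT.sw_right k fun t => (1 : A) ⊗ₜ[R] t
      refine ⟨κ.rTensor _ w, fun n => ?_⟩
      induction n with
      | zero => simp
      | add n n' hn hn' => simp only [map_add, hn, hn']
      | tmul b k =>
        rw [smashRep_tmul, theta_tmul, smashRep_of_sw (hB.coaction_gammaTilde_mul_iota b k),
          dualAct_of_sw (tensorCoaction_tmul R H A b k)]
        simp only [hα, mul_sw, linearMap_map_sw, mul_smul_comm, map_smul,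
          Algebra.TensorProduct.tmul_mul_tmul, theta_tmul]
        -- The factor `γ(T ·)` at the end of `hα` meets the `γ̃` of `θ(b ⊗ k)` and cancels, leaving
        -- `∑ f(k₂) γ̃(h k₁) ι(a b)`.
        calc _ = sw R k fun s k₂ => (f : Module.Dual R H) k₂ • sw R s fun s' k₁ =>
                gammaTilde T σ' ι γ (h * k₁) * (ι a * ((sw R s' fun x t =>
                  γ (T t) * gammaTilde T σ' ι γ x) * ι b)) := by
              simp (disch := fun_prop) only [sw_coassoc', sw_mul_const, mul_sw, smul_sw,
                smul_mul_assoc, mul_assoc]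
          _ = _ := by
              simp only [hB.gamma_mul_gammaTilde hσ hT hB.bijective, smul_mul_assoc, one_mul,
                mul_smul_comm, map_mul]
              simp (disch := fun_prop) only [sw_counit_left']

end Duality

/-! ### Injectivity of `α` over a Noetherian ring -/

section Purity

variable {R : Type u} [CommRing R]

/-- Flatness: `α` is natural in the module, so injectivity is tested after evaluation at each
functional. -/
theorem IsLocallyProjective.rTensor_injective {W : Type v} [AddCommGroup W] [Module R W]
    (hW : IsLocallyProjective R W) {X Y : Type*} [AddCommMonoid X] [Module R X]
    [AddCommMonoid Y] [Module R Y] {g : X →ₗ[R] Y} (hg : Function.Injective g) :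
    Function.Injective (g.rTensor W) := by
  have h : ∀ t f, alphaMap (LinearMap.id : Module.Dual R W →ₗ[R] (W →ₗ[R] R)) Y
      (g.rTensor W t) f = g (alphaMap (LinearMap.id : Module.Dual R W →ₗ[R] (W →ₗ[R] R)) X t f) := by
    intro t f
    induction t with
    | zero => simp
    | add x y hx hy => simp only [map_add, LinearMap.add_apply, hx, hy]
    | tmul x w => simp
  intro s t hst
  -- `alphaMap_injective` needs an additive group; multiplication by `-1` supplies the negation.
  let := Module.addCommMonoidToAddCommGroup R (M := X)
  apply hW.alphaMap_injective X
  ext f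
  apply hg
  rw [← h, ← h, hst]

/-- The canonical map `M ⊗ R^Λ → M^Λ`. -/
noncomputable def tensorFunToFun (R : Type*) [CommRing R] (M Λ : Type*) [AddCommGroup M]
    [Module R M] : M ⊗[R] (Λ → R) →ₗ[R] Λ → M :=
  LinearMap.pi fun l => TensorProduct.rid R M ∘ₗ LinearMap.lTensor M (LinearMap.proj l)

theorem tensorFunToFun_tmul {M Λ : Type*} [AddCommGroup M] [Module R M] (m : M) (c : Λ → R)
    (l : Λ) : tensorFunToFun R M Λ (m ⊗ₜ c) l = c l • m := by
  simp [tensorFunToFun]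

theorem tensorFunToFun_injective [IsNoetherianRing R] (M Λ : Type*) [AddCommGroup M]
    [Module R M] : Function.Injective (tensorFunToFun R M Λ) := by
  rw [injective_iff_map_eq_zero]
  intro t ht
  obtain ⟨s, rfl⟩ := TensorProduct.exists_finset t
  -- The module of relations among the first components is finitely generated. All vectors of values
  -- of the second components lie in it, so the coefficients `d` give finitely many functions on
  -- `Λ`, and moving `κ` across the tensor sign leaves only relations.
  let K : Submodule R (s → R) := LinearMap.ker (Fintype.linearCombination R fun i : s => i.1.1)
  obtain ⟨p, κ, hκ⟩ := Submodule.fg_iff_exists_fin_generating_family.mp (IsNoetherian.noetherian K)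
  have hK : ∀ l, ∃ d : Fin p → R, ∀ i : s, i.1.2 l = ∑ j, d j * κ j i := by
    intro l
    have : (fun i : s => i.1.2 l) ∈ K := by
      have := congrFun ht l
      simp only [map_sum, Finset.sum_apply, tensorFunToFun_tmul] at this
      rw [LinearMap.mem_ker, Fintype.linearCombination_apply]
      exact (Finset.sum_coe_sort s fun i => i.2 l • i.1).trans this
    rw [← hκ, Submodule.mem_span_range_iff_exists_fun] at this
    obtain ⟨d, hd⟩ := this
    exact ⟨d, fun i => by simpa using (congrFun hd i).symm⟩
  choose d hd using hK
  have hrel : ∀ j, ∑ i : s, κ j i • i.1.1 = 0 := by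
    intro j
    have : κ j ∈ K := by rw [← hκ]; exact Submodule.subset_span ⟨j, rfl⟩
    rwa [LinearMap.mem_ker, Fintype.linearCombination_apply] at this
  have hc : ∀ i : s, i.1.2 = ∑ j, κ j i • fun l => d l j := fun i => by
    ext l
    simp [hd l i, Finset.sum_apply, mul_comm]
  rw [← Finset.sum_coe_sort s fun i => i.1 ⊗ₜ[R] i.2]
  calc _ = ∑ i : s, ∑ j, (κ j i • i.1.1) ⊗ₜ[R] fun l => d l j := by
        refine Finset.sum_congr rfl fun i _ => ?_
        conv_lhs => rw [hc i]
        simp [TensorProduct.tmul_sum, TensorProduct.smul_tmul']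
    _ = 0 := by
        rw [Finset.sum_comm]
        simp only [← TensorProduct.sum_tmul, hrel, TensorProduct.zero_tmul, Finset.sum_const_zero]

/-- Purity is assumed only for `A`; tensoring with the flat module `H` extends it to `A ⊗ H`. -/
theorem alphaMap_injective_of_pure [IsNoetherianRing R] {H : Type v} [Ring H] [Bialgebra R H]
    (hH : IsLocallyProjective R H) {A : Type w} [AddCommGroup A] [Module R A]
    (U : Submodule R (Module.Dual R H))
    (hU : Function.Injective
      (LinearMap.rTensor A (LinearMap.ltoFun R H R R ∘ₗ U.subtype))) :
    Function.Injective (alphaMap (evalPairing U) (A ⊗[R] H)) := by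
  have h : ∀ z k, alphaMap (evalPairing U) (A ⊗[R] H) z k =
      tensorFunToFun R (A ⊗[R] H) H
        ((LinearMap.ltoFun R H R R ∘ₗ U.subtype).lTensor (A ⊗[R] H) z) k := by
    intro z k
    induction z with
    | zero => simp
    | add x y hx hy => simp only [map_add, LinearMap.add_apply, hx, hy, Pi.add_apply]
    | tmul n f =>
      rw [alphaMap_evalPairing_tmul, LinearMap.lTensor_tmul, tensorFunToFun_tmul]
      rfl
  have hj : Function.Injective
      ((LinearMap.ltoFun R H R R ∘ₗ U.subtype).lTensor (A ⊗[R] H)) := by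
    have := hH.rTensor_injective
      (g := LinearMap.rTensor A (LinearMap.ltoFun R H R R ∘ₗ U.subtype)) hU
    rw [LinearMap.lTensor_inj_iff_rTensor_inj, LinearMap.rTensor_tensor]
    simpa using this
  intro z w hzw
  apply hj
  apply tensorFunToFun_injective
  ext k
  rw [← h, ← h, hzw]

end Purity

/-! ### Crossed products are cleft comodule algebras -/

section Crossed

variable {R : Type u} [CommRing R] {H : Type v} [Ring H] [Bialgebra R H]
  {A : Type w} [Ring A] [Algebra R A] {act : H →ₗ[R] A →ₗ[R] A} {σ : H ⊗[R] H →ₗ[R] A}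

theorem CrossedProduct.mk_mul_mk (a b : A) (h k : H) :
    (CrossedProduct.mk act σ a h * CrossedProduct.mk act σ b k : CrossedProduct act σ) =
      sw R h fun h₁ y => sw R y fun h₂ h₃ => sw R k fun k₁ k₂ =>
        ((a * (act h₁ b * σ (h₂ ⊗ₜ k₁))) ⊗ₜ[R] (h₃ * k₂) : A ⊗[R] H) := by
  rw [CrossedProduct.mul_def]
  simp only [CrossedProduct.mul, CrossedProduct.mk, LinearMap.comp_apply, LinearEquiv.coe_coe,
    TensorProduct.assoc_tmul, LinearMap.lTensor_tmul, CrossedProduct.twistMul,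
    LinearMap.rTensor_tmul, comul_eq_sw h, sw_tmul_const, linearMap_map_sw,
    TensorProduct.tensorTensorTensorComm_tmul, TensorProduct.map_tmul, TensorProduct.lift.tmul,
    CrossedProduct.cocycleMul, comul_eq_sw, tmul_sw, CrossedProduct.leftMul,
    TensorProduct.assoc_symm_tmul, LinearMap.mul'_apply]
  exact sw_congr (M := A ⊗[R] H) _ fun h₁ y => sw_comm (R := R) (M := A ⊗[R] H) ..

namespace IsCrossedProduct

theorem act_one (hA : IsCrossedProduct act σ) (h : H) : act h 1 = counit (R := R) h • 1 := by
  have := LinearMap.congr_fun (congrArg WithConv.ofConv hA.isWeakAction.map_one) h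
  simpa [Algebra.algebraMap_eq_smul_one] using this

/-- Normalisation of the cocycle is not an axiom: it follows by applying `id ⊗ ε` to `(1 # 1)(1 # k)
= 1 # k`. -/
theorem cocycle_one_left (hA : IsCrossedProduct act σ) (k : H) :
    σ (1 ⊗ₜ k) = counit (R := R) k • 1 := by
  have h := (CrossedProduct.mk_mul_mk (act := act) (σ := σ) 1 1 1 k).symm.trans (hA.one_mul _)
  obtain ⟨r, hr⟩ := exists_lift (R := R) fun (a : A) (h : H) => counit (R := R) h • a
  have := congrArg r h
  simp (disch := fun_prop) only [sw_one', CrossedProduct.mk, linearMap_map_sw, hr, _root_.one_mul,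
    sw_counit_right', hA.isWeakAction.one_act] at this
  exact this

theorem cocycle_one_right (hA : IsCrossedProduct act σ) (h : H) :
    σ (h ⊗ₜ 1) = counit (R := R) h • 1 := by
  have h := (CrossedProduct.mk_mul_mk (act := act) (σ := σ) 1 1 h 1).symm.trans (hA.mul_one _)
  obtain ⟨r, hr⟩ := exists_lift (R := R) fun (a : A) (h : H) => counit (R := R) h • a
  have := congrArg r h
  simp (disch := fun_prop) only [sw_one', CrossedProduct.mk, linearMap_map_sw, hr, _root_.one_mul, _root_.mul_one,
    sw_counit_right', sw_counit_left', hA.act_one, smul_mul_assoc] at this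
  exact this

/-- The ring structure of a crossed product. -/
abbrev ring (hA : IsCrossedProduct act σ) : Ring (CrossedProduct act σ) where
  -- Reusing the given addition and product keeps the smash product over this ring definitionally
  -- equal to the one in the theorem.
  __ := (inferInstance : NonUnitalNonAssocRing (CrossedProduct act σ))
  mul_assoc := hA.mul_assoc
  one := CrossedProduct.mk act σ 1 1
  one_mul := hA.one_mul
  mul_one := hA.mul_one

/-- The algebra structure of a crossed product. -/
abbrev algebra (hA : IsCrossedProduct act σ) :
    letI := hA.ring
    Algebra R (CrossedProduct act σ) :=
  letI := hA.ring
  Algebra.ofModule smul_mul_assoc mul_smul_comm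

theorem mk_mul_mk_one (hA : IsCrossedProduct act σ) (a b : A) (h : H) :
    (CrossedProduct.mk act σ a h * CrossedProduct.mk act σ b 1 : CrossedProduct act σ) =
      sw R h fun x y => CrossedProduct.mk act σ (a * act x b) y := by
  rw [CrossedProduct.mk_mul_mk]
  simp (disch := fun_prop) only [sw_one', hA.cocycle_one_right, _root_.mul_one, mul_smul_comm,
    ← TensorProduct.smul_tmul', sw_counit_left']
  rfl

theorem mk_one_mul_mk (hA : IsCrossedProduct act σ) (a b : A) (k : H) :
    (CrossedProduct.mk act σ a 1 * CrossedProduct.mk act σ b k : CrossedProduct act σ) =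
      CrossedProduct.mk act σ (a * b) k := by
  rw [CrossedProduct.mk_mul_mk]
  simp (disch := fun_prop) only [sw_one', hA.cocycle_one_left, _root_.mul_one, mul_smul_comm, _root_.one_mul,
    ← TensorProduct.smul_tmul', sw_counit_left', hA.isWeakAction.one_act]
  rfl

theorem mk_one_left_mul (hA : IsCrossedProduct act σ) (h k : H) :
    (CrossedProduct.mk act σ 1 h * CrossedProduct.mk act σ 1 k : CrossedProduct act σ) =
      sw R h fun x y => sw R k fun p q => CrossedProduct.mk act σ (σ (x ⊗ₜ p)) (y * q) := by
  rw [CrossedProduct.mk_mul_mk]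
  simp (disch := fun_prop) only [hA.act_one, smul_mul_assoc, _root_.one_mul,
    ← TensorProduct.smul_tmul', ← smul_sw, sw_counit_left']
  rfl

/-- A crossed product is a cleft comodule algebra. -/
theorem exists_isCleftComodule (hA : IsCrossedProduct act σ) :
    letI := hA.ring
    letI := hA.algebra
    ∃ (ι : A →ₐ[R] CrossedProduct act σ) (γ : H →ₗ[R] CrossedProduct act σ),
      IsCleftComodule act σ ι γ (CrossedProduct.coaction act σ) := by
  let := hA.ring
  let := hA.algebra
  let ι : A →ₐ[R] CrossedProduct act σ := AlgHom.ofLinearMap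
    ((TensorProduct.mk R A H).flip 1 : A →ₗ[R] A ⊗[R] H) rfl
    (fun a b => (hA.mk_one_mul_mk a b 1).symm)
  let γ : H →ₗ[R] CrossedProduct act σ := (TensorProduct.mk R A H 1 : H →ₗ[R] A ⊗[R] H)
  have hι : ∀ a, ι a = CrossedProduct.mk act σ a 1 := fun a => rfl
  have hγ : ∀ h, γ h = CrossedProduct.mk act σ 1 h := fun h => rfl
  have hmk : ∀ a h, ι a * γ h = CrossedProduct.mk act σ a h := fun a h => by
    rw [hι, hγ, hA.mk_one_mul_mk, _root_.mul_one]
  refine ⟨ι, γ, ⟨?_, ?_, ?_⟩, ?_, ?_⟩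
  · rfl
  · intro h a
    simp only [hmk]
    rw [hι, hγ, hA.mk_mul_mk_one]
    simp only [_root_.one_mul]
  · intro h k
    simp only [hmk]
    rw [hγ, hγ, hA.mk_one_left_mul]
  -- The map `a ⊗ h ↦ ι(a) γ(h)` is the identity of the common underlying module.
  · have : ∀ z : A ⊗[R] H, TensorProduct.lift ((LinearMap.mul R (CrossedProduct act σ)).compl₁₂
        ι.toLinearMap γ) z = z := by
      intro z
      induction z with
      | zero => simp; rfl
      | add x y hx hy => rw [map_add, hx, hy]; rfl
      | tmul a h => exact hmk a h
    exact ⟨fun x y h => (this x).symm.trans (h.trans (this y)), fun x => ⟨x, this x⟩⟩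
  · intro a h
    simp only [hmk]
    exact tensorCoaction_tmul R H A a h

end IsCrossedProduct

end Crossed

/-! ### Assembling the isomorphism -/

section Assemble

variable {R : Type u} [CommRing R] {H : Type v} [Ring H] [Bialgebra R H]
  {A : Type w} [Ring A] [Algebra R A]

theorem smashProduct_mul_of_sw {B : Type*} [Ring B] [Algebra R B] {ρ : B →ₗ[R] B ⊗[R] H}
    {U : RightModuleSubalgebra R H} {b c : B} {f g : U.toSubmodule} {k : H} {u : H → B}
    (h : ρ c = sw R k fun x y => u x ⊗ₜ[R] y) :
    SmashProduct.mul ρ U ((b ⊗ₜ f) ⊗ₜ (c ⊗ₜ g)) =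
      sw R k fun x y => (b * u x) ⊗ₜ[R] U.conv (U.act f y) g := by
  simp only [SmashProduct.mul, LinearMap.comp_apply, LinearMap.lTensor_tmul,
    LinearMap.rTensor_tmul, h, sw, TensorProduct.sum_tmul, TensorProduct.tmul_sum, map_sum,
    LinearEquiv.coe_coe, TensorProduct.assoc_tmul,
    TensorProduct.tensorTensorTensorComm_tmul, TensorProduct.map_tmul, LinearMap.mul'_apply,
    SmashProduct.actConv, TensorProduct.assoc_symm_tmul, TensorProduct.lift.tmul]

/-- `(A ⊗ H) # U = A ⊗ (H # U)`. -/
noncomputable def smashTensorEquiv (R : Type u) [CommRing R] (H : Type v) [Ring H] [Bialgebra R H]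
    (A : Type w) [Ring A] [Algebra R A] (U : RightModuleSubalgebra R H) :
    SmashProduct (tensorCoaction R H A) U ≃ₗ[R]
      A ⊗[R] SmashProduct (comul (R := R) (A := H)) U :=
  TensorProduct.assoc R A H U.toSubmodule

/-- The coaction on `A ⊗ H` touches only the factor `H`, so the `A`-components just multiply. -/
theorem smashTensorEquiv_mul (U : RightModuleSubalgebra R H)
    (x y : SmashProduct (tensorCoaction R H A) U) :
    smashTensorEquiv R H A U (x * y) = smashTensorEquiv R H A U x * smashTensorEquiv R H A U y := by
  suffices h : (LinearMap.mul R _).compr₂ (smashTensorEquiv R H A U).toLinearMap =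
      (LinearMap.mul R (A ⊗[R] SmashProduct (comul (R := R) (A := H)) U)).compl₁₂
        (smashTensorEquiv R H A U).toLinearMap (smashTensorEquiv R H A U).toLinearMap from
    LinearMap.congr_fun₂ h x y
  refine TensorProduct.ext_threefold fun a h f => TensorProduct.ext_threefold fun b k g => ?_
  have h₁ := smashProduct_mul_of_sw (U := U) (b := a ⊗ₜ[R] h) (f := f) (g := g)
    (tensorCoaction_tmul R H A b k)
  have h₂ := smashProduct_mul_of_sw (U := U) (b := h) (f := f) (g := g) (comul_eq_sw (R := R) k)
  refine (congrArg (TensorProduct.assoc R A H U.toSubmodule) h₁).trans ?_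
  have h₃ := Algebra.TensorProduct.tmul_mul_tmul (R := R) a b
    (SmashProduct.mk (comul (R := R) (A := H)) U h f) (SmashProduct.mk comul U k g)
  refine .trans ?_ h₃.symm
  refine .trans ?_ (congrArg (fun t : SmashProduct (comul (R := R) (A := H)) U =>
    (a * b) ⊗ₜ[R] t) h₂).symm
  simp only [linearEquiv_map_sw, Algebra.TensorProduct.tmul_mul_tmul, TensorProduct.assoc_tmul]
  exact (tmul_sw (a * b) k fun x y => (h * x) ⊗ₜ[R] U.conv (U.act f y) g).symm

theorem exists_smashProduct_equiv (hH : IsLocallyProjective R H) {T : H →ₗ[R] H}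
    (hT : IsTwistedAntipode T) {act : H →ₗ[R] A →ₗ[R] A} {σ σ' : H ⊗[R] H →ₗ[R] A}
    (hσ : IsConvInverse σ σ') (U : RightModuleSubalgebra R H)
    (hφ : LinearMap.range (phi T act σ) ≤
      LinearMap.range (alphaMap (evalPairing (upsilonPreimage T hH U.toSubmodule)) A))
    (hψ : LinearMap.range (psi T act σ σ') ≤
      LinearMap.range (alphaMap (evalPairing (upsilonPreimage T hH U.toSubmodule)) A))
    {B : Type*} [Ring B] [Algebra R B] {ι : A →ₐ[R] B} {γ : H →ₗ[R] B} {ρ : B →ₗ[R] B ⊗[R] H}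
    (hB : IsCleftComodule act σ ι γ ρ)
    (hαB : Function.Injective (alphaMap (evalPairing U.toSubmodule) B))
    (hα : Function.Injective (alphaMap (evalPairing U.toSubmodule) (A ⊗[R] H))) :
    ∃ e : SmashProduct ρ U ≃ₗ[R] SmashProduct (tensorCoaction R H A) U,
      (∀ x y, e (x * y) = e x * e y) ∧ ∀ hε : counit (R := R) (A := H) ∈ U.toSubmodule,
        e (SmashProduct.mk ρ U 1 ⟨counit, hε⟩) = SmashProduct.mk _ U 1 ⟨counit, hε⟩ := by
  have hN := isCleftComodule_tensor R H A
  have hBi : Function.Injective (smashRep ρ U) := by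
    refine smashRep_injective (u := gammaTilde T σ' ι γ) (v := γ ∘ₗ T) (fun k => ?_)
      (hB.gammaTilde_mul_gamma hσ hT) hαB
    simpa using hB.coaction_gammaTilde_mul_iota (T := T) (σ' := σ') 1 k
  have hNi : Function.Injective (smashRep (tensorCoaction R H A) U) := by
    refine smashRep_injective
      (u := (Algebra.TensorProduct.includeRight : H →ₐ[R] A ⊗[R] H).toLinearMap)
      (v := (Algebra.TensorProduct.includeRight : H →ₐ[R] A ⊗[R] H).toLinearMap ∘ₗ T)
      hN.coaction_gamma (fun k => ?_) hα
    simpa [Algebra.TensorProduct.one_def] using hT.sw_right k fun t => (1 : A) ⊗ₜ[R] t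
  obtain ⟨e, he, hθ⟩ := exists_mulEquiv_of_conj (P := SmashProduct ρ U)
    (Q := SmashProduct (tensorCoaction R H A) U) hBi hNi
    (smashRep_mul hB.isComoduleAlgebra) (smashRep_mul hN.isComoduleAlgebra)
    ⟨hB.theta_injective hσ hT, hB.theta_surjective hσ hT⟩
    (exists_smashRep_theta hB hσ hH hT hφ) (exists_theta_smashRep hB hσ hH hT hψ)
  -- Both elements `1 # ε` act as the identity, so faithfulness identifies them under `e`.
  refine ⟨e, he, fun hε => hNi (LinearMap.ext fun n => hB.theta_injective hσ hT ?_)⟩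
  refine (hθ _ n).symm.trans ?_
  refine (smashRep_counit hB.isComoduleAlgebra hε _).trans ?_
  exact congrArg _ (smashRep_counit hN.isComoduleAlgebra hε n).symm

end Assemble

end HopfDuality

theorem mainTheorem5 {R : Type u} [CommRing R] {H : Type v} [Ring H] [HopfAlgebra R H]
    {A : Type w} [Ring A] [Algebra R A]
    (hH : HopfDuality.IsLocallyProjective R H)
    (T : H →ₗ[R] H) (hT : HopfDuality.IsTwistedAntipode T)
    (act : H →ₗ[R] A →ₗ[R] A) (σ σ' : H ⊗[R] H →ₗ[R] A)
    (hA : HopfDuality.IsCrossedProduct act σ) (hσ : HopfDuality.IsConvInverse σ σ')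
    (U : HopfDuality.RightModuleSubalgebra R H)
    (hφ : LinearMap.range (HopfDuality.phi T act σ) ≤
      LinearMap.range (HopfDuality.alphaMap (HopfDuality.evalPairing
        (HopfDuality.upsilonPreimage T hH U.toSubmodule)) A))
    (hψ : LinearMap.range (HopfDuality.psi T act σ σ') ≤
      LinearMap.range (HopfDuality.alphaMap (HopfDuality.evalPairing
        (HopfDuality.upsilonPreimage T hH U.toSubmodule)) A)) :
    (Function.Injective
        (HopfDuality.alphaMap (HopfDuality.evalPairing U.toSubmodule) (A ⊗[R] H)) →
      ∃ e : HopfDuality.SmashProduct (HopfDuality.CrossedProduct.coaction act σ) U ≃ₗ[R]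
          A ⊗[R] HopfDuality.SmashProduct (Coalgebra.comul (R := R) (A := H)) U,
        (∀ x y, e (x * y) = e x * e y) ∧
        ∀ hε : Coalgebra.counit (R := R) (A := H) ∈ U.toSubmodule,
          e (HopfDuality.SmashProduct.mk (HopfDuality.CrossedProduct.coaction act σ) U
              (HopfDuality.CrossedProduct.mk act σ 1 1) ⟨Coalgebra.counit, hε⟩) =
            1 ⊗ₜ[R] HopfDuality.SmashProduct.mk (Coalgebra.comul (R := R) (A := H)) U
              1 ⟨Coalgebra.counit, hε⟩) ∧
    (IsNoetherianRing R →
      Function.Injective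
        (LinearMap.rTensor A (LinearMap.ltoFun R H R R ∘ₗ U.toSubmodule.subtype)) →
      Function.Injective
        (HopfDuality.alphaMap (HopfDuality.evalPairing U.toSubmodule) (A ⊗[R] H))) := by
  refine ⟨fun hα => ?_, fun hR hU =>
    HopfDuality.alphaMap_injective_of_pure hH U.toSubmodule hU⟩
  let := hA.ring
  let := hA.algebra
  obtain ⟨ι, γ, hB⟩ := hA.exists_isCleftComodule
  -- `α` involves only the underlying module, which is `A ⊗ H` for both algebras, so the one
  -- assumption makes both actions faithful.
  obtain ⟨e, he, hone⟩ := HopfDuality.exists_smashProduct_equiv hH hT hσ U hφ hψ hB hα hα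
  refine ⟨e.trans (HopfDuality.smashTensorEquiv R H A U), fun x y => ?_, fun hε => ?_⟩
  · exact (congrArg _ (he x y)).trans (HopfDuality.smashTensorEquiv_mul U _ _)
  · exact congrArg (HopfDuality.smashTensorEquiv R H A U) (hone hε)
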